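/- **Setting.** Let $(\Omega,\mathcal F,(\mathcal F_t)_{t\in\mathbb N},\mathbb P)$ be a filtered probability space and let $d\ge 1$. Let $S(t)=(S_1(t),\dots,S_d(t))$, $t\in\mathbb N=\{0,1,\dots\}$, be an adapted price process with strictly positive entries. Put $r_i(t)=\ln\frac{S_i(t)}{S_i(t-1)}$ and $w_i(t)=e^{r_i(t)}$ for $t\ge 1$. Assume that the vectors $r(t)$ are i.i.d. with respect to the filtration: they are identically distributed, and $r(t+1)$ is independent of $\mathcal F_t$ for every $t\ge0$. Let $c,h\in\mathbb R^d$ be cost rates with $0<c_j,h_j<1$, let $\mathrm{cost}(x)=\langle c,[x]^+\rangle+\langle h,[x]^-\rangle$ for $x\in\mathbb R^d$, where $[x]^\pm$ are the componentwise positive and negative parts, and let $\mathcal S=\{x\in\mathbb R^d: x_j\ge 0,\ \sum_j x_j=1\}$. An *initial endowment* is an $\mathcal F_0$-measurable vector $N(0-)$ with nonnegative entries such that $W(0-)=\langle N(0-),S(0)\rangle$ is a deterministic positive number; put $N(t-)=N(t-1)$ for $t\ge1$. A *trading strategy* is an adapted process $N(t)\in\mathbb R_+^d$, $t\in\mathbb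 N$ (holdings after rebalancing), that is self-financing: with $W(t-)=\langle N(t-),S(t)\rangle$, $W(t)=\langle N(t),S(t)\rangle$ and pointwise products, $$W(t)=W(t-)-\mathrm{cost}\big((N(t)-N(t-))\cdot S(t)\big),\qquad t\in\mathbb N .$$ Its weights before and after rebalancing are $\pi(t-)=N(t-)\cdot S(t)/W(t-)$ and $\pi(t)=N(t)\cdot S(t)/W(t)$; both lie in $\mathcal S$. For $\gamma\neq0$ let $\mu^\gamma(X)=\frac1\gamma\ln\mathbb E[e^{\gamma X}]$. The long-run value of the strategy is $$J(\pi)=\liminf_{n\to\infty}\frac1n\,\mu^\gamma\big(\ln W(n-)\big).$$ For $x,y\in\mathcal S$ let $s(x,y)\in(0,1]$ be the unique real number with $s(x,y)+\mathrm{cost}(s(x,y)\,y-x)=1$ (so that $W(t)/W(t-)=s(\pi(t-),\pi(t))$), and let $G(x,y)=x\cdot y/\langle x,y\rangle$. **Theorem.** Let $\gamma<0$. Assume * (A.1) $\mathbb E[e^{\gamma r_i(1)}]<\infty$ and $\mathbb E|r_i(1)|<\infty$ for $i=1,\dots,d$; * (A.2) for every $\delta\in(0,1/d)$, with $\mathcal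 S_\delta=\{\pi\in\mathcal S:\min_i\pi_i\ge\delta\}$, $$\sup_{A\in\mathcal B(\mathcal S)}\ \sup_{\pi,\pi'\in\mathcal S_\delta}\Big(\mathbb P[G(\pi,w(1))\in A]-\mathbb P[G(\pi',w(1))\in A]\Big)<1 .$$ Then there are a constant $\lambda\in\mathbb R$ and a continuous bounded function $v:\mathcal S\to\mathbb R$ such that 1. for every $\pi\in\mathcal S$, $$v(\pi)+\lambda=\gamma\sup_{\pi'\in\mathcal S}\Big[\mu^\gamma\Big(\ln\langle\pi',w(1)\rangle+\ln s(\pi,\pi')+\gamma^{-1}v\big(G(\pi',w(1))\big)\Big)\Big];$$ 2. for every initial endowment, $\Lambda:=\lambda/\gamma$ is the optimal value: $\Lambda=\sup_\pi J(\pi)$, the supremum being over all trading strategies with that endowment; 3. selectors of the Bellman equation define optimal strategies: there is a Borel map $u:\mathcal S\to\mathcal S$ such that $\pi'=u(\pi)$ attains the supremum in 1 for every $\pi\in\mathcal S$; and for every such $u$ and every initial endowment there is a trading strategy with $\pi(t)=u(\pi(t-))$ for all $t\in\mathbb N$, and every such strategy satisfies $J(\pi)=\Lambda$. -/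

import Mathlib

open MeasureTheory ProbabilityTheory Filter

namespace Portfolio

variable {Ω : Type*} {d : ℕ}

/-- Entropic utility `μ^γ(X) = γ⁻¹ log E[exp (γ X)]`, with values in the extended reals. -/
noncomputable def entropicUtility [MeasurableSpace Ω] (P : Measure Ω) (γ : ℝ) (X : Ω → ℝ) : EReal :=
  ((γ⁻¹ : ℝ) : EReal) * ENNReal.log (∫⁻ ω, ENNReal.ofReal (Real.exp (γ * X ω)) ∂P)

/-- Proportional transaction cost penalty `⟨c, x⁺⟩ + ⟨h, x⁻⟩`. -/
def tradingCost (c h x : Fin d → ℝ) : ℝ :=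
  ∑ i, (c i * max (x i) 0 + h i * max (-x i) 0)

/-- The capital decay `s(x, y)`: the number `w` with `w + cost (w y - x) = 1`. It is the fraction of
the wealth that is left after rebalancing from the weights `x` to the weights `y`. -/
noncomputable def decay (c h x y : Fin d → ℝ) : ℝ :=
  Classical.epsilon fun w : ℝ => w + tradingCost c h (w • y - x) = 1

/-- `G(x, y) = x · y / ⟨x, y⟩`, the product and the quotient being taken pointwise. -/
noncomputable def drift (x y : Fin d → ℝ) : Fin d → ℝ :=
  fun i => x i * y i / ∑ j, x j * y j

/-- `priceRatio S t` is the vector `w(t+1) = S(t+1) / S(t)` of relative price changes. -/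
noncomputable def priceRatio (S : ℕ → Ω → Fin d → ℝ) (t : ℕ) (ω : Ω) : Fin d → ℝ :=
  fun i => S (t + 1) ω i / S t ω i

/-- `logReturn S t` is the log-return vector `r(t+1)`, where `r_i(t+1) = log (S_i(t+1) / S_i(t))`. -/
noncomputable def logReturn (S : ℕ → Ω → Fin d → ℝ) (t : ℕ) (ω : Ω) : Fin d → ℝ :=
  fun i => Real.log (S (t + 1) ω i / S t ω i)

/-- Holdings before the rebalancing at time `t`: the initial endowment `N₀` if `t = 0`, and `N(t-1)`
otherwise. -/
def preHoldings (N₀ : Ω → Fin d → ℝ) (N : ℕ → Ω → Fin d → ℝ) : ℕ → Ω → Fin d → ℝ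
  | 0 => N₀
  | t + 1 => N t

/-- Wealth `W(t-)` before the rebalancing at time `t`. -/
def preWealth (S : ℕ → Ω → Fin d → ℝ) (N₀ : Ω → Fin d → ℝ) (N : ℕ → Ω → Fin d → ℝ)
    (t : ℕ) (ω : Ω) : ℝ :=
  ∑ i, preHoldings N₀ N t ω i * S t ω i

/-- Wealth `W(t)` after the rebalancing at time `t`. -/
def postWealth (S : ℕ → Ω → Fin d → ℝ) (N : ℕ → Ω → Fin d → ℝ) (t : ℕ) (ω : Ω) : ℝ :=
  ∑ i, N t ω i * S t ω i

/-- Weights `π(t-)` before the rebalancing at time `t`. -/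
noncomputable def preWeights (S : ℕ → Ω → Fin d → ℝ) (N₀ : Ω → Fin d → ℝ)
    (N : ℕ → Ω → Fin d → ℝ) (t : ℕ) (ω : Ω) : Fin d → ℝ :=
  fun i => preHoldings N₀ N t ω i * S t ω i / preWealth S N₀ N t ω

/-- Weights `π(t)` after the rebalancing at time `t`. -/
noncomputable def postWeights (S : ℕ → Ω → Fin d → ℝ) (N : ℕ → Ω → Fin d → ℝ)
    (t : ℕ) (ω : Ω) : Fin d → ℝ :=
  fun i => N t ω i * S t ω i / postWealth S N t ω

/-- An initial endowment: known at time `0`, without short positions, and worth a deterministic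
positive amount. -/
structure IsEndowment [MeasurableSpace Ω] (ℱ : Filtration ℕ ‹MeasurableSpace Ω›)
    (S : ℕ → Ω → Fin d → ℝ) (N₀ : Ω → Fin d → ℝ) : Prop where
  measurable : Measurable[ℱ 0] N₀
  nonneg : ∀ ω i, 0 ≤ N₀ ω i
  wealth : ∃ x : ℝ, 0 < x ∧ ∀ ω, ∑ i, N₀ ω i * S 0 ω i = x

/-- A trading strategy (holdings after rebalancing): adapted, without short selling, and
self-financing under proportional transaction costs. -/
structure IsTradingStrategy [MeasurableSpace Ω] (ℱ : Filtration ℕ ‹MeasurableSpace Ω›)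
    (S : ℕ → Ω → Fin d → ℝ) (c h : Fin d → ℝ) (N₀ : Ω → Fin d → ℝ)
    (N : ℕ → Ω → Fin d → ℝ) : Prop where
  measurable : ∀ t, Measurable[ℱ t] (N t)
  nonneg : ∀ t ω i, 0 ≤ N t ω i
  selfFinancing : ∀ t ω, postWealth S N t ω = preWealth S N₀ N t ω
    - tradingCost c h (fun i => (N t ω i - preHoldings N₀ N t ω i) * S t ω i)

/-- The long-run risk-sensitive value `J = liminf (1/n) μ^γ(log W(n-))`. -/
noncomputable def longRunValue [MeasurableSpace Ω] (P : Measure Ω) (γ : ℝ)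
    (S : ℕ → Ω → Fin d → ℝ) (N₀ : Ω → Fin d → ℝ) (N : ℕ → Ω → Fin d → ℝ) : EReal :=
  liminf (fun n : ℕ =>
    entropicUtility P γ (fun ω => Real.log (preWealth S N₀ N n ω)) / (n : EReal)) atTop

/-- The mixing condition: for each `0 < δ < 1/d`, the supremum over Borel sets `A` and over weights
`p`, `q` with all entries at least `δ` of `P[G(p, w) ∈ A] - P[G(q, w) ∈ A]` is less than one. -/
def Mixing [MeasurableSpace Ω] (P : Measure Ω) (w : Ω → Fin d → ℝ) : Prop :=
  ∀ δ : ℝ, 0 < δ → δ < 1 / (d : ℝ) → ∃ ρ : ℝ, ρ < 1 ∧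
    ∀ A : Set (Fin d → ℝ), MeasurableSet A →
      ∀ p ∈ stdSimplex ℝ (Fin d), (∀ i, δ ≤ p i) →
        ∀ q ∈ stdSimplex ℝ (Fin d), (∀ i, δ ≤ q i) →
          P.real {ω | drift p (w ω) ∈ A} - P.real {ω | drift q (w ω) ∈ A} ≤ ρ

/-- `μ^γ(log ⟨q, w⟩ + log s(p, q) + γ⁻¹ v(G(q, w)))`, where `p` and `q` are the weights before and
after rebalancing. -/
noncomputable def bellmanObjective [MeasurableSpace Ω] (P : Measure Ω) (γ : ℝ)
    (w : Ω → Fin d → ℝ) (c h : Fin d → ℝ) (v : (Fin d → ℝ) → ℝ) (p q : Fin d → ℝ) : EReal :=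
  entropicUtility P γ (fun ω =>
    Real.log (∑ i, q i * w ω i) + Real.log (decay c h p q) + γ⁻¹ * v (drift q (w ω)))

/-- A measurable selector of the Bellman equation: `u p` is a maximiser of the Bellman objective over
the simplex, for each `p` in the simplex. -/
structure IsBellmanSelector [MeasurableSpace Ω] (P : Measure Ω) (γ : ℝ)
    (w : Ω → Fin d → ℝ) (c h : Fin d → ℝ) (v : (Fin d → ℝ) → ℝ)
    (u : (Fin d → ℝ) → Fin d → ℝ) : Prop where
  measurable : Measurable u
  mem : ∀ p ∈ stdSimplex ℝ (Fin d), u p ∈ stdSimplex ℝ (Fin d)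
  isMax : ∀ p ∈ stdSimplex ℝ (Fin d), ∀ q ∈ stdSimplex ℝ (Fin d),
    bellmanObjective P γ w c h v p q ≤ bellmanObjective P γ w c h v p (u p)

theorem tradingCost_nonneg {c h : Fin d → ℝ} (hc : ∀ i, 0 < c i ∧ c i < 1)
    (hh : ∀ i, 0 < h i ∧ h i < 1) (x : Fin d → ℝ) : 0 ≤ tradingCost c h x :=
  Finset.sum_nonneg fun i _ => add_nonneg
    (mul_nonneg (hc i).1.le (le_max_right _ _)) (mul_nonneg (hh i).1.le (le_max_right _ _))

theorem sum_mul_lt_one {h : Fin d → ℝ} (hh : ∀ i, 0 < h i ∧ h i < 1) {x : Fin d → ℝ}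
    (hx : x ∈ stdSimplex ℝ (Fin d)) : ∑ i, h i * x i < 1 := by
  obtain ⟨i, hi⟩ : ∃ i, 0 < x i := by
    by_contra! H
    have : ∑ i, x i ≤ 0 := Finset.sum_nonpos fun i _ => H i
    linarith [hx.2]
  calc ∑ i, h i * x i < ∑ i, x i :=
        Finset.sum_lt_sum (fun j _ => by nlinarith [hx.1 j, (hh j).2])
          ⟨i, Finset.mem_univ i, by nlinarith [(hh i).2]⟩
    _ = 1 := hx.2

theorem strictMono_decay_aux {c h : Fin d → ℝ} (hc : ∀ i, 0 < c i ∧ c i < 1)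
    (hh : ∀ i, 0 < h i ∧ h i < 1) {x y : Fin d → ℝ} (hy : y ∈ stdSimplex ℝ (Fin d)) :
    StrictMono fun w : ℝ => w + tradingCost c h (w • y - x) := by
  intro a b hab
  have key : tradingCost c h (a • y - x) ≤
      tradingCost c h (b • y - x) + (b - a) * ∑ i, h i * y i := by
    unfold tradingCost
    rw [Finset.mul_sum, ← Finset.sum_add_distrib]
    refine Finset.sum_le_sum fun i _ => ?_
    have hle : a * y i - x i ≤ b * y i - x i := by nlinarith [hy.1 i]
    have h1 : max (a * y i - x i) 0 ≤ max (b * y i - x i) 0 := max_le_max_right 0 hle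
    have h2 : max (-(a * y i - x i)) 0 ≤ max (-(b * y i - x i)) 0 + (b - a) * y i := by
      have h3 := le_max_left (-(b * y i - x i)) 0
      have h4 := le_max_right (-(b * y i - x i)) 0
      exact max_le (by linarith) (by linarith)
    have h5 := mul_le_mul_of_nonneg_left h1 (hc i).1.le
    have h6 := mul_le_mul_of_nonneg_left h2 (hh i).1.le
    simp only [Pi.sub_apply, Pi.smul_apply, smul_eq_mul]
    linarith
  have := sum_mul_lt_one hh hy
  show a + _ < b + _
  nlinarith

/-- On the simplex the defining equation of `decay` has exactly one solution, and it lies in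
`(0, 1]`. -/
theorem decay_spec {c h : Fin d → ℝ} (hc : ∀ i, 0 < c i ∧ c i < 1)
    (hh : ∀ i, 0 < h i ∧ h i < 1) {x y : Fin d → ℝ} (hx : x ∈ stdSimplex ℝ (Fin d))
    (hy : y ∈ stdSimplex ℝ (Fin d)) :
    (∀ w : ℝ, w + tradingCost c h (w • y - x) = 1 ↔ w = decay c h x y) ∧
      0 < decay c h x y ∧ decay c h x y ≤ 1 := by
  have hmono := strictMono_decay_aux (x := x) hc hh hy
  have hcont : Continuous fun w : ℝ => w + tradingCost c h (w • y - x) := by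
    unfold tradingCost
    simp only [Pi.sub_apply, Pi.smul_apply, smul_eq_mul]
    fun_prop
  have h0 : (0 : ℝ) + tradingCost c h ((0 : ℝ) • y - x) < 1 := by
    have e : tradingCost c h ((0 : ℝ) • y - x) = ∑ i, h i * x i := by
      unfold tradingCost
      refine Finset.sum_congr rfl fun i _ => ?_
      have := hx.1 i
      simp [this]
    rw [e, zero_add]
    exact sum_mul_lt_one hh hx
  have h1 : 1 ≤ (1 : ℝ) + tradingCost c h ((1 : ℝ) • y - x) := by
    linarith [tradingCost_nonneg hc hh ((1 : ℝ) • y - x)]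
  obtain ⟨w, -, hw⟩ := intermediate_value_Icc zero_le_one hcont.continuousOn
    (show (1 : ℝ) ∈ Set.Icc _ _ from ⟨h0.le, h1⟩)
  have hs : decay c h x y + tradingCost c h (decay c h x y • y - x) = 1 :=
    Classical.epsilon_spec (p := fun w : ℝ => w + tradingCost c h (w • y - x) = 1) ⟨w, hw⟩
  refine ⟨fun a => ⟨fun ha => hmono.injective (ha.trans hs.symm), fun ha => ha ▸ hs⟩, ?_, ?_⟩
  · exact hmono.lt_iff_lt.1 (h0.trans_eq hs.symm)
  · exact hmono.le_iff_le.1 (hs.trans_le h1)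

end Portfolio

/-!
Since the exponent `γ` is negative, maximising the entropic utility of the log-wealth means
minimising `E[W ^ γ]`, and the Bellman equation reads
`v p + lam = min_q (γ log s(p, q) + log E[⟨q, w⟩ ^ γ * exp (v (G(q, w)))])`.
Two features make it solvable by compactness. The second summand does not depend on `p`, and the
first is continuous on the product of two simplices, because `s` is continuous and bounded away from
zero there: rebalancing between any two weights costs at most a fixed fraction of the wealth. Hence
all images of the operator on the right-hand side share one modulus of continuity
(`dist_minOperator_le`). The operator is nonexpansive in the supremum norm and commutes with the
addition of constants, so its discounted versions are contractions; their fixed points, normalised at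
a point of the simplex, are relatively compact by the Arzelà–Ascoli theorem, and a limit point as the
discount factor tends to one is a solution (`exists_minOperator_eigenvector`).

The minimised expression is continuous in `q` up to the boundary of the simplex (`exists_logGrowth`),
because `⟨q, w⟩ ^ γ` is dominated by the sum of the `w_i ^ γ`, which are integrable by assumption.
Thus minimisers exist, and they can be chosen in a Borel way (`exists_measurable_argmin`).

For the verification, self-financing gives `W(t) = s(π(t-), π(t)) W(t-)`, and the price change is
independent of the past, so `E[W(t-) ^ γ * exp (v (π(t-)))] exp (-t lam)` is nondecreasing in `t` for
every strategy (`mul_weightedMoment_le`) and constant for a strategy that follows a selector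
(`weightedMoment_eq_mul`). As `v` is bounded, `E[W(n-) ^ γ]` grows at least at the rate `lam`, and
exactly at this rate for a selector; dividing by `γ` turns this into the optimality of `lam / γ`.
-/

namespace Portfolio

open scoped Topology

/-! ### Minima of continuous functions on a compact space -/

section CompactMinimum

variable {K : Type*} [TopologicalSpace K] [CompactSpace K]

theorem bddBelow_range_of_compactSpace (f : C(K, ℝ)) : BddBelow (Set.range f) :=
  (isCompact_range f.continuous).bddBelow

variable [Nonempty K]

theorem exists_eq_iInf_of_compactSpace (f : C(K, ℝ)) : ∃ y, f y = ⨅ z, f z := by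
  obtain ⟨y, -, hy⟩ := isCompact_univ.exists_isMinOn Set.univ_nonempty f.continuous.continuousOn
  exact ⟨y, le_antisymm (le_ciInf fun z => hy (Set.mem_univ z))
    (ciInf_le (bddBelow_range_of_compactSpace f) y)⟩

theorem iInf_le_iInf_add_dist (f g : C(K, ℝ)) : ⨅ y, f y ≤ (⨅ y, g y) + dist f g := by
  obtain ⟨y, hy⟩ := exists_eq_iInf_of_compactSpace g
  have h1 := ciInf_le (bddBelow_range_of_compactSpace f) y
  have h2 := (le_abs_self _).trans (ContinuousMap.dist_apply_le_dist (f := f) (g := g) y)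
  linarith

theorem lipschitzWith_iInf : LipschitzWith 1 fun f : C(K, ℝ) => ⨅ y, f y := by
  refine LipschitzWith.of_dist_le_mul fun f g => ?_
  have h1 := iInf_le_iInf_add_dist f g
  have h2 := iInf_le_iInf_add_dist g f
  rw [dist_comm] at h2
  rw [Real.dist_eq, abs_le, NNReal.coe_one]
  constructor <;> linarith

end CompactMinimum

/-! ### Additive eigenvectors of minimum operators -/

section Eigenvector

variable {K : Type*} [TopologicalSpace K] [CompactSpace K]

/-- Functions that vanish at a given point and obey a fixed modulus of continuity form a compact
set. -/
theorem isCompact_setOf_dist_le (D : C(K, C(K, ℝ))) (x₀ : K) :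
    IsCompact {u : C(K, ℝ) | u x₀ = 0 ∧ ∀ x y, dist (u x) (u y) ≤ dist (D x) (D y)} := by
  have small : ∀ (x : K) (ε : ℝ), 0 < ε → ∀ᶠ y in 𝓝 x, dist (D x) (D y) < ε := by
    intro x ε hε
    have : Tendsto (fun y => dist (D x) (D y)) (𝓝 x) (𝓝 (dist (D x) (D x))) :=
      (continuous_const.dist D.continuous).tendsto x
    rw [dist_self] at this
    exact this.eventually (gt_mem_nhds hε)
  refine ArzelaAscoli.isCompact_of_equicontinuous _ ?_ ?_
  · have hset : ContinuousMap.toFun ''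
        {u : C(K, ℝ) | u x₀ = 0 ∧ ∀ x y, dist (u x) (u y) ≤ dist (D x) (D y)} =
        {u : K → ℝ | u x₀ = 0 ∧ ∀ x y, dist (u x) (u y) ≤ dist (D x) (D y)} := by
      ext u
      constructor
      · rintro ⟨f, hf, rfl⟩
        exact hf
      · intro hu
        refine ⟨⟨u, ?_⟩, hu, rfl⟩
        rw [continuous_iff_continuousAt]
        intro x
        rw [ContinuousAt, Metric.tendsto_nhds]
        intro ε hε
        filter_upwards [small x ε hε] with y hy
        rw [dist_comm]
        exact (hu.2 x y).trans_lt hy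
    rw [hset]
    refine IsCompact.of_isClosed_subset (isCompact_univ_pi fun x =>
      isCompact_closedBall (0 : ℝ) (dist (D x) (D x₀))) ?_ ?_
    · simp only [Set.ofPred_and, Set.ofPred_forall]
      refine IsClosed.inter (isClosed_eq (continuous_apply _) continuous_const) ?_
      exact isClosed_iInter fun x => isClosed_iInter fun y =>
        isClosed_le ((continuous_apply x).dist (continuous_apply y)) continuous_const
    · intro u hu x _
      have := hu.2 x x₀
      rwa [hu.1] at this
  · intro x
    rw [Metric.equicontinuousAt_iff_right]
    intro ε hε
    filter_upwards [small x ε hε] with y hy u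
    exact (u.2.2 x y).trans_lt hy

variable [Nonempty K]

/-- The operator `f ↦ (x ↦ min_y (D x y + Γ f y))` on continuous functions. -/
noncomputable def minOperator (D : C(K, C(K, ℝ))) (Γ : C(K, ℝ) → C(K, ℝ)) (f : C(K, ℝ)) :
    C(K, ℝ) where
  toFun x := ⨅ y, (D x + Γ f) y
  continuous_toFun := lipschitzWith_iInf.continuous.comp (by fun_prop)

variable {D : C(K, C(K, ℝ))} {Γ : C(K, ℝ) → C(K, ℝ)}

theorem minOperator_apply (f : C(K, ℝ)) (x : K) :
    minOperator D Γ f x = ⨅ y, (D x + Γ f) y := rfl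

theorem minOperator_lipschitz (hΓ : LipschitzWith 1 Γ) : LipschitzWith 1 (minOperator D Γ) := by
  refine LipschitzWith.of_dist_le_mul fun f g => ?_
  rw [NNReal.coe_one, one_mul, ContinuousMap.dist_le dist_nonneg]
  intro x
  have h1 := lipschitzWith_iInf.dist_le_mul (D x + Γ f) (D x + Γ g)
  have h2 := hΓ.dist_le_mul f g
  rw [NNReal.coe_one, one_mul] at h1 h2
  rw [dist_add_left] at h1
  exact h1.trans h2

theorem minOperator_add_const (hΓc : ∀ f (a : ℝ), Γ (f + ContinuousMap.const K a) =
    Γ f + ContinuousMap.const K a) (f : C(K, ℝ)) (a : ℝ) :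
    minOperator D Γ (f + ContinuousMap.const K a) =
      minOperator D Γ f + ContinuousMap.const K a := by
  ext x
  rw [ContinuousMap.add_apply, minOperator_apply, minOperator_apply, hΓc]
  simp only [ContinuousMap.const_apply]
  rw [ciInf_add (bddBelow_range_of_compactSpace _)]
  simp [add_assoc]

/-- The modulus of continuity of an image of the operator does not depend on the function. -/
theorem dist_minOperator_le (f : C(K, ℝ)) (x y : K) :
    dist (minOperator D Γ f x) (minOperator D Γ f y) ≤ dist (D x) (D y) := by
  have h1 := lipschitzWith_iInf.dist_le_mul (D x + Γ f) (D y + Γ f)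
  rwa [NNReal.coe_one, one_mul, dist_add_right] at h1

/-- A nonexpansive minimum operator that commutes with the addition of constants has an additive
eigenvector. The fixed points of the discounted operators `f ↦ T (β f)`, normalised at a point, have
a common modulus of continuity, so they accumulate as the discount factor tends to one. -/
theorem exists_minOperator_eigenvector (hΓ : LipschitzWith 1 Γ)
    (hΓc : ∀ f (a : ℝ), Γ (f + ContinuousMap.const K a) = Γ f + ContinuousMap.const K a) :
    ∃ (v : C(K, ℝ)) (lam : ℝ), ∀ x, v x + lam = ⨅ y, (D x + Γ v) y := by
  obtain ⟨x₀⟩ := ‹Nonempty K›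
  have : Nonempty K := ⟨x₀⟩
  set T := minOperator D Γ with hT
  have hTl : LipschitzWith 1 T := minOperator_lipschitz hΓ
  have discounted : ∀ β : ℝ, 0 ≤ β → β < 1 → ∃ u : C(K, ℝ),
      (u x₀ = 0 ∧ ∀ x y, dist (u x) (u y) ≤ dist (D x) (D y)) ∧
        u + ContinuousMap.const K (T (β • u) x₀) = T (β • u) := by
    intro β h0 h1
    lift β to NNReal using h0
    have hcon : ContractingWith β fun f : C(K, ℝ) => T ((β : ℝ) • f) := by
      refine ⟨h1, LipschitzWith.of_dist_le_mul fun f g => ?_⟩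
      refine (hTl.dist_le_mul _ _).trans ?_
      rw [NNReal.coe_one, one_mul]
      refine (dist_smul_le (β : ℝ) f g).trans_eq ?_
      rw [Real.norm_of_nonneg β.coe_nonneg]
    set f := hcon.fixedPoint
    have hf : T ((β : ℝ) • f) = f := hcon.fixedPoint_isFixedPt
    -- Subtracting a constant from the fixed point changes the equation by a constant only.
    have hshift : T ((β : ℝ) • (f + ContinuousMap.const K (-f x₀))) =
        f + ContinuousMap.const K (-(β * f x₀)) := by
      have : (β : ℝ) • (f + ContinuousMap.const K (-f x₀)) =
          (β : ℝ) • f + ContinuousMap.const K (-(β * f x₀)) := by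
        ext x
        simp only [ContinuousMap.smul_apply, ContinuousMap.add_apply, ContinuousMap.const_apply,
          smul_eq_mul]
        ring
      rw [this, hT, minOperator_add_const hΓc, ← hT, hf]
    refine ⟨f + ContinuousMap.const K (-f x₀), ⟨by simp, fun x y => ?_⟩, ?_⟩
    · have := dist_minOperator_le (D := D) (Γ := Γ) ((β : ℝ) • f) x y
      rw [← hT, hf] at this
      simpa using! this
    · rw [hshift]
      ext x
      simp
  have hβ0 : ∀ n : ℕ, (0 : ℝ) ≤ 1 - 1 / ((n : ℝ) + 1) := fun n => by
    rw [sub_nonneg, div_le_one (by positivity)]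
    linarith [n.cast_nonneg (α := ℝ)]
  have hβ1 : ∀ n : ℕ, 1 - 1 / ((n : ℝ) + 1) < 1 := fun n => by
    have : 0 < 1 / ((n : ℝ) + 1) := by positivity
    linarith
  choose u hu hTu using fun n : ℕ => discounted _ (hβ0 n) (hβ1 n)
  obtain ⟨v, -, φ, hφ, hlim⟩ := (isCompact_setOf_dist_le D x₀).tendsto_subseq hu
  have hβ : Tendsto (fun n : ℕ => 1 - 1 / ((φ n : ℝ) + 1)) atTop (𝓝 1) := by
    have := (tendsto_one_div_add_atTop_nhds_zero_nat (𝕜 := ℝ)).comp hφ.tendsto_atTop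
    simpa using! this.const_sub 1
  have hlimT : Tendsto (fun n => T ((1 - 1 / ((φ n : ℝ) + 1)) • u (φ n))) atTop (𝓝 (T v)) := by
    have := hβ.smul hlim
    rw [one_smul] at this
    exact (hTl.continuous.tendsto v).comp this
  have heval : ∀ x : K, Continuous fun f : C(K, ℝ) => f x := fun x =>
    continuous_eval_const x
  refine ⟨v, T v x₀, fun x => ?_⟩
  have h1 := (((heval x).tendsto v).comp hlim).add (((heval x₀).tendsto (T v)).comp hlimT)
  have h2 := ((heval x).tendsto (T v)).comp hlimT
  refine tendsto_nhds_unique h1 (h2.congr fun n => ?_)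
  have := congrArg (fun f : C(K, ℝ) => f x) (hTu (φ n))
  simpa using! this.symm

end Eigenvector

/-! ### Measurable selection of minimisers -/

/-- A continuous function on a product with a compact metric factor has a Borel selector of
minimisers. The compact factor is a continuous image of the Cantor set, and the least point of the
Cantor set that is mapped to a minimiser depends lower semicontinuously on the parameter. -/
theorem exists_measurable_argmin {X K : Type*} [TopologicalSpace X] [MeasurableSpace X]
    [OpensMeasurableSpace X] [MetricSpace K] [CompactSpace K] [Nonempty K] [MeasurableSpace K]
    [BorelSpace K] (f : X → K → ℝ) (hf : Continuous (Function.uncurry f)) :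
    ∃ u : X → K, Measurable u ∧ ∀ x y, f x (u x) ≤ f x y := by
  obtain ⟨φ, hφc, hφs⟩ := exists_nat_bool_continuous_surjective_of_compact K
  set ψ : cantorSet → K := φ ∘ cantorSetHomeomorphNatToBool
  have hψc : Continuous ψ := hφc.comp cantorSetHomeomorphNatToBool.continuous
  have hψs : Function.Surjective ψ := hφs.comp cantorSetHomeomorphNatToBool.surjective
  have : CompactSpace cantorSet := isCompact_iff_compactSpace.1 isCompact_cantorSet
  have hclosed : IsClosed {z : X × cantorSet | ∀ y, f z.1 (ψ z.2) ≤ f z.1 y} := by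
    simp only [Set.ofPred_forall]
    refine isClosed_iInter fun y => isClosed_le ?_ ?_
    · exact hf.comp (continuous_fst.prodMk (hψc.comp continuous_snd))
    · exact hf.comp (continuous_fst.prodMk continuous_const)
  have hleast : ∀ x, ∃ t : cantorSet, IsLeast {t : cantorSet | ∀ y, f x (ψ t) ≤ f x y} t := by
    intro x
    have hc : IsCompact {t : cantorSet | ∀ y, f x (ψ t) ≤ f x y} :=
      (hclosed.preimage (Continuous.prodMk_right x)).isCompact
    refine hc.exists_isLeast ?_
    have hfx : Continuous (f x) := hf.comp (Continuous.prodMk_right x)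
    obtain ⟨y, -, hy⟩ := isCompact_univ.exists_isMinOn Set.univ_nonempty hfx.continuousOn
    obtain ⟨t, rfl⟩ := hψs y
    exact ⟨t, fun z => hy (Set.mem_univ z)⟩
  choose τ hτ using hleast
  have hτm : Measurable fun x => (τ x : ℝ) := by
    refine measurable_of_Iic fun a => ?_
    have : (fun x => (τ x : ℝ)) ⁻¹' Set.Iic a = Prod.fst ''
        ({z : X × cantorSet | ∀ y, f z.1 (ψ z.2) ≤ f z.1 y} ∩ {z | (z.2 : ℝ) ≤ a}) := by
      ext x
      constructor
      · intro hx
        exact ⟨(x, τ x), ⟨(hτ x).1, hx⟩, rfl⟩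
      · rintro ⟨⟨_, t⟩, ⟨h1, h2⟩, rfl⟩
        exact (Subtype.coe_le_coe.2 ((hτ _).2 h1)).trans h2
    rw [this]
    refine (isClosedMap_fst_of_compactSpace _ (hclosed.inter ?_)).measurableSet
    exact isClosed_le (by fun_prop) continuous_const
  exact ⟨fun x => ψ (τ x), hψc.measurable.comp (hτm.subtype_mk (h := fun x => (τ x).2)),
    fun x => (hτ x).1⟩

variable {Ω : Type*} {d : ℕ}

/-! ### The capital decay and the weight dynamics -/

theorem continuous_tradingCost (c h : Fin d → ℝ) : Continuous (tradingCost c h) := by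
  unfold tradingCost
  fun_prop

/-- The capital decay is continuous, being the solution of an equation that is strictly monotone in
the unknown and continuous in the parameters. -/
theorem continuous_decay {c h : Fin d → ℝ} (hc : ∀ i, 0 < c i ∧ c i < 1)
    (hh : ∀ i, 0 < h i ∧ h i < 1) :
    Continuous fun z : stdSimplex ℝ (Fin d) × stdSimplex ℝ (Fin d) =>
      decay c h z.1.1 z.2.1 := by
  have hF : ∀ a : ℝ, Continuous fun z : stdSimplex ℝ (Fin d) × stdSimplex ℝ (Fin d) =>
      a + tradingCost c h (a • z.2.1 - z.1.1) := fun a =>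
    continuous_const.add ((continuous_tradingCost c h).comp (by fun_prop))
  have hroot : ∀ z : stdSimplex ℝ (Fin d) × stdSimplex ℝ (Fin d),
      decay c h z.1.1 z.2.1 + tradingCost c h (decay c h z.1.1 z.2.1 • z.2.1 - z.1.1) = 1 :=
    fun z => ((decay_spec hc hh z.1.2 z.2.2).1 _).2 rfl
  rw [OrderTopology.continuous_iff]
  intro a
  constructor
  · convert! isOpen_lt (hF a) (continuous_const (y := (1 : ℝ))) using 1
    ext z
    rw [Set.mem_preimage, Set.mem_Ioi, Set.mem_ofPred_eq, ← hroot z,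
      (strictMono_decay_aux (x := z.1.1) hc hh z.2.2).lt_iff_lt]
  · convert! isOpen_lt (continuous_const (y := (1 : ℝ))) (hF a) using 1
    ext z
    rw [Set.mem_preimage, Set.mem_Iio, Set.mem_ofPred_eq, ← hroot z,
      (strictMono_decay_aux (x := z.1.1) hc hh z.2.2).lt_iff_lt]

theorem measurable_decay {c h : Fin d → ℝ} (hc : ∀ i, 0 < c i ∧ c i < 1)
    (hh : ∀ i, 0 < h i ∧ h i < 1) :
    Measurable fun z : stdSimplex ℝ (Fin d) × stdSimplex ℝ (Fin d) => decay c h z.1.1 z.2.1 :=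
  (continuous_decay hc hh).measurable

theorem sum_mul_pos_of_mem_stdSimplex {q w : Fin d → ℝ} (hq : q ∈ stdSimplex ℝ (Fin d))
    (hw : ∀ i, 0 < w i) : 0 < ∑ i, q i * w i := by
  obtain ⟨i, hi⟩ : ∃ i, 0 < q i := by
    by_contra! H
    linarith [hq.2, Finset.sum_nonpos fun i (_ : i ∈ Finset.univ) => H i]
  exact Finset.sum_pos' (fun j _ => mul_nonneg (hq.1 j) (hw j).le)
    ⟨i, Finset.mem_univ i, mul_pos hi (hw i)⟩

theorem drift_mem_stdSimplex {q w : Fin d → ℝ} (hq : q ∈ stdSimplex ℝ (Fin d))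
    (hw : ∀ i, 0 < w i) : drift q w ∈ stdSimplex ℝ (Fin d) := by
  have hpos := sum_mul_pos_of_mem_stdSimplex hq hw
  refine ⟨fun i => div_nonneg (mul_nonneg (hq.1 i) (hw i).le) hpos.le, ?_⟩
  simp only [drift]
  rw [← Finset.sum_div, div_self hpos.ne']

theorem measurable_drift :
    Measurable fun z : (Fin d → ℝ) × (Fin d → ℝ) => drift z.1 z.2 := by
  unfold drift
  fun_prop

/-- A function on the simplex, extended by zero to the whole space. -/
noncomputable def extendByZero (f : C(stdSimplex ℝ (Fin d), ℝ)) : (Fin d → ℝ) → ℝ :=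
  Function.extend Subtype.val f 0

theorem extendByZero_apply (f : C(stdSimplex ℝ (Fin d), ℝ)) {p : Fin d → ℝ}
    (hp : p ∈ stdSimplex ℝ (Fin d)) : extendByZero f p = f ⟨p, hp⟩ :=
  Subtype.val_injective.extend_apply f 0 ⟨p, hp⟩

theorem measurable_extendByZero (f : C(stdSimplex ℝ (Fin d), ℝ)) :
    Measurable (extendByZero f) :=
  (MeasurableEmbedding.subtype_coe (isClosed_stdSimplex ℝ (Fin d)).measurableSet).measurable_extend
    f.continuous.measurable measurable_zero

theorem abs_extendByZero_le (f : C(stdSimplex ℝ (Fin d), ℝ)) {p : Fin d → ℝ}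
    (hp : p ∈ stdSimplex ℝ (Fin d)) : |extendByZero f p| ≤ ‖f‖ := by
  rw [extendByZero_apply f hp]
  exact f.norm_coe_le_norm _

/-! ### The one-period growth functional -/

/-- The contribution `⟨q, w⟩ ^ γ * exp (f (G (q, w)))` of the price change `w` to the one-period
growth functional. -/
noncomputable def growthKernel (γ : ℝ) (f : (Fin d → ℝ) → ℝ) (q w : Fin d → ℝ) : ℝ :=
  Real.exp (γ * Real.log (∑ i, q i * w i) + f (drift q w))

theorem measurable_growthKernel (γ : ℝ) {f : (Fin d → ℝ) → ℝ} (hf : Measurable f) :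
    Measurable fun z : (Fin d → ℝ) × (Fin d → ℝ) => growthKernel γ f z.1 z.2 := by
  have := hf.comp (measurable_drift (d := d))
  unfold growthKernel
  refine Real.measurable_exp.comp (Measurable.add ?_ this)
  exact (Real.measurable_log.comp (by fun_prop)).const_mul γ

/-- A portfolio does not grow more slowly than its worst asset, so that for a negative exponent the
growth kernel is dominated by the sum over all assets. -/
theorem growthKernel_le {γ : ℝ} (hγ : γ < 0) (f : C(stdSimplex ℝ (Fin d), ℝ))
    {q w : Fin d → ℝ} (hq : q ∈ stdSimplex ℝ (Fin d)) (hw : ∀ i, 0 < w i) :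
    growthKernel γ (extendByZero f) q w ≤
      (∑ i, Real.exp (γ * Real.log (w i))) * Real.exp ‖f‖ := by
  have hd : Nonempty (Fin d) := by
    by_contra H
    rw [not_nonempty_iff] at H
    simpa using hq.2
  obtain ⟨j, hj⟩ := Finite.exists_min w
  have h1 : w j ≤ ∑ i, q i * w i := by
    calc w j = ∑ i, q i * w j := by rw [← Finset.sum_mul, hq.2, one_mul]
      _ ≤ _ := Finset.sum_le_sum fun i _ => mul_le_mul_of_nonneg_left (hj i) (hq.1 i)
  have h2 : γ * Real.log (∑ i, q i * w i) ≤ γ * Real.log (w j) :=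
    mul_le_mul_of_nonpos_left (Real.log_le_log (hw j) h1) hγ.le
  have h3 : Real.exp (γ * Real.log (w j)) ≤ ∑ i, Real.exp (γ * Real.log (w i)) :=
    Finset.single_le_sum (f := fun i => Real.exp (γ * Real.log (w i)))
      (fun i _ => (Real.exp_pos _).le) (Finset.mem_univ j)
  rw [growthKernel, Real.exp_add]
  gcongr
  · exact (Real.exp_le_exp.2 h2).trans h3
  · exact (le_abs_self _).trans (abs_extendByZero_le f (drift_mem_stdSimplex hq hw))

theorem continuous_growthKernel (γ : ℝ) (f : C(stdSimplex ℝ (Fin d), ℝ)) {w : Fin d → ℝ}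
    (hw : ∀ i, 0 < w i) :
    Continuous fun q : stdSimplex ℝ (Fin d) => growthKernel γ (extendByZero f) q.1 w := by
  have hne : ∀ q : stdSimplex ℝ (Fin d), ∑ i, q.1 i * w i ≠ 0 := fun q =>
    (sum_mul_pos_of_mem_stdSimplex q.2 hw).ne'
  have hcoord : ∀ i, Continuous fun q : stdSimplex ℝ (Fin d) => q.1 i := fun i =>
    (continuous_apply i).comp continuous_subtype_val
  have hsum : Continuous fun q : stdSimplex ℝ (Fin d) => ∑ i, q.1 i * w i :=
    continuous_finsetSum _ fun i _ => (hcoord i).mul continuous_const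
  have hdrift : Continuous fun q : stdSimplex ℝ (Fin d) =>
      (⟨drift q.1 w, drift_mem_stdSimplex q.2 hw⟩ : stdSimplex ℝ (Fin d)) :=
    Continuous.subtype_mk (continuous_pi fun i =>
      ((hcoord i).mul continuous_const).div hsum hne) _
  have heq : (fun q : stdSimplex ℝ (Fin d) => growthKernel γ (extendByZero f) q.1 w) =
      fun q : stdSimplex ℝ (Fin d) => Real.exp (γ * Real.log (∑ i, q.1 i * w i) +
        f ⟨drift q.1 w, drift_mem_stdSimplex q.2 hw⟩) := by
    funext q
    rw [growthKernel, extendByZero_apply f (drift_mem_stdSimplex q.2 hw)]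
  rw [heq]
  exact Real.continuous_exp.comp ((continuous_const.mul (hsum.log hne)).add
    (f.continuous.comp hdrift))

section Growth

variable [MeasurableSpace Ω] {P : Measure Ω} {γ : ℝ}
  {w : Ω → Fin d → ℝ}

theorem integrable_growthKernel (hγ : γ < 0) (hw : Measurable w) (hpos : ∀ ω i, 0 < w ω i)
    (hint : ∀ i, Integrable (fun ω => Real.exp (γ * Real.log (w ω i))) P)
    (f : C(stdSimplex ℝ (Fin d), ℝ)) {q : Fin d → ℝ} (hq : q ∈ stdSimplex ℝ (Fin d)) :
    Integrable (fun ω => growthKernel γ (extendByZero f) q (w ω)) P := by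
  refine Integrable.mono' ((integrable_finsetSum Finset.univ fun i _ => hint i).mul_const
    (Real.exp ‖f‖)) ?_ ?_
  · exact ((measurable_growthKernel γ (measurable_extendByZero f)).comp
      (measurable_const.prodMk hw)).aestronglyMeasurable
  · refine ae_of_all _ fun ω => ?_
    rw [growthKernel, Real.norm_of_nonneg (Real.exp_pos _).le]
    exact growthKernel_le hγ f hq (hpos ω)

variable [IsProbabilityMeasure P]

theorem integral_growthKernel_pos (hγ : γ < 0) (hw : Measurable w) (hpos : ∀ ω i, 0 < w ω i)
    (hint : ∀ i, Integrable (fun ω => Real.exp (γ * Real.log (w ω i))) P)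
    (f : C(stdSimplex ℝ (Fin d), ℝ)) {q : Fin d → ℝ} (hq : q ∈ stdSimplex ℝ (Fin d)) :
    0 < ∫ ω, growthKernel γ (extendByZero f) q (w ω) ∂P :=
  integral_exp_pos (integrable_growthKernel hγ hw hpos hint f hq)

/-- The logarithmic growth functional `q ↦ log E[⟨q, w⟩ ^ γ * exp (f (G (q, w)))]` is continuous up
to the boundary of the simplex, nonexpansive in `f`, and commutes with the addition of constants. -/
theorem exists_logGrowth (hγ : γ < 0) (hw : Measurable w) (hpos : ∀ ω i, 0 < w ω i)
    (hint : ∀ i, Integrable (fun ω => Real.exp (γ * Real.log (w ω i))) P) :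
    ∃ Γ : C(stdSimplex ℝ (Fin d), ℝ) → C(stdSimplex ℝ (Fin d), ℝ), LipschitzWith 1 Γ ∧
      (∀ f (a : ℝ), Γ (f + ContinuousMap.const _ a) = Γ f + ContinuousMap.const _ a) ∧
      ∀ f q, Real.exp (Γ f q) = ∫ ω, growthKernel γ (extendByZero f) q.1 (w ω) ∂P := by
  have hI : ∀ (f) (q : stdSimplex ℝ (Fin d)),
      Integrable (fun ω => growthKernel γ (extendByZero f) q.1 (w ω)) P := fun f q =>
    integrable_growthKernel hγ hw hpos hint f q.2
  have hP : ∀ (f) (q : stdSimplex ℝ (Fin d)),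
      0 < ∫ ω, growthKernel γ (extendByZero f) q.1 (w ω) ∂P := fun f q =>
    integral_growthKernel_pos hγ hw hpos hint f q.2
  have hcont : ∀ f, Continuous fun q : stdSimplex ℝ (Fin d) =>
      Real.log (∫ ω, growthKernel γ (extendByZero f) q.1 (w ω) ∂P) := by
    intro f
    refine Continuous.log ?_ fun q => (hP f q).ne'
    refine continuous_of_dominated (bound := fun ω =>
      (∑ i, Real.exp (γ * Real.log (w ω i))) * Real.exp ‖f‖)
      (fun q => (hI f q).aestronglyMeasurable) (fun q => ae_of_all _ fun ω => ?_) ?_ ?_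
    · rw [growthKernel, Real.norm_of_nonneg (Real.exp_pos _).le]
      exact growthKernel_le hγ f q.2 (hpos ω)
    · exact (integrable_finsetSum Finset.univ fun i _ => hint i).mul_const _
    · exact ae_of_all _ fun ω => continuous_growthKernel γ f (hpos ω)
  have hle : ∀ f g (q : stdSimplex ℝ (Fin d)) (a : ℝ), (∀ x, f x ≤ g x + a) →
      Real.log (∫ ω, growthKernel γ (extendByZero f) q.1 (w ω) ∂P) ≤
        Real.log (∫ ω, growthKernel γ (extendByZero g) q.1 (w ω) ∂P) + a := by
    intro f g q a hfg
    rw [← Real.log_exp a, ← Real.log_mul (hP g q).ne' (Real.exp_pos a).ne']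
    refine Real.log_le_log (hP f q) ?_
    rw [← integral_mul_const]
    refine integral_mono (hI f q) ((hI g q).mul_const _) fun ω => ?_
    have hm := drift_mem_stdSimplex q.2 (hpos ω)
    simp only [growthKernel, extendByZero_apply _ hm]
    rw [← Real.exp_add, Real.exp_le_exp]
    linarith [hfg ⟨_, hm⟩]
  refine ⟨fun f => ⟨_, hcont f⟩, ?_, fun f a => ?_, fun f q => Real.exp_log (hP f q)⟩
  · refine LipschitzWith.of_dist_le_mul fun f g => ?_
    rw [NNReal.coe_one, one_mul, ContinuousMap.dist_le dist_nonneg]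
    intro q
    have hd : ∀ x, |f x - g x| ≤ dist f g := fun x =>
      ContinuousMap.dist_apply_le_dist (f := f) (g := g) x
    have h1 := hle f g q (dist f g) fun x => by linarith [(abs_le.1 (hd x)).2]
    have h2 := hle g f q (dist f g) fun x => by linarith [(abs_le.1 (hd x)).1]
    rw [Real.dist_eq, abs_le]
    simp only [ContinuousMap.coe_mk]
    constructor <;> linarith
  · ext q
    have h1 := hle (f + ContinuousMap.const _ a) f q a fun x => by simp
    have h2 := hle f (f + ContinuousMap.const _ a) q (-a) fun x => by simp
    simp only [ContinuousMap.add_apply, ContinuousMap.coe_mk, ContinuousMap.const_apply]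
    linarith

/-- Real form of the Bellman equation: `v + lam` is the pointwise minimum over `q` of the sum of
the rebalancing cost `γ log s(p, q)` and the logarithmic growth `g q`. -/
theorem exists_bellman_solution (hd : 0 < d) {c h : Fin d → ℝ} (hc : ∀ i, 0 < c i ∧ c i < 1)
    (hh : ∀ i, 0 < h i ∧ h i < 1) (hγ : γ < 0) (hw : Measurable w) (hpos : ∀ ω i, 0 < w ω i)
    (hint : ∀ i, Integrable (fun ω => Real.exp (γ * Real.log (w ω i))) P) :
    ∃ (v g : C(stdSimplex ℝ (Fin d), ℝ)) (lam : ℝ),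
      (∀ q : stdSimplex ℝ (Fin d),
        ∫⁻ ω, ENNReal.ofReal (growthKernel γ (extendByZero v) q.1 (w ω)) ∂P =
          ENNReal.ofReal (Real.exp (g q))) ∧
      (∀ p q : stdSimplex ℝ (Fin d), v p + lam ≤ γ * Real.log (decay c h p.1 q.1) + g q) ∧
      ∃ u : stdSimplex ℝ (Fin d) → stdSimplex ℝ (Fin d), Measurable u ∧
        ∀ p, v p + lam = γ * Real.log (decay c h p.1 (u p).1) + g (u p) := by
  have : Nonempty (Fin d) := ⟨⟨0, hd⟩⟩
  have hK : Nonempty (stdSimplex ℝ (Fin d)) := inferInstance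
  obtain ⟨Γ, hΓ, hΓc, hΓe⟩ := exists_logGrowth hγ hw hpos hint
  have hD : Continuous fun z : stdSimplex ℝ (Fin d) × stdSimplex ℝ (Fin d) =>
      γ * Real.log (decay c h z.1.1 z.2.1) :=
    continuous_const.mul ((continuous_decay hc hh).log fun z =>
      (decay_spec hc hh z.1.2 z.2.2).2.1.ne')
  set D : C(stdSimplex ℝ (Fin d), C(stdSimplex ℝ (Fin d), ℝ)) :=
    ContinuousMap.curry ⟨_, hD⟩
  obtain ⟨v, lam, hv⟩ := exists_minOperator_eigenvector (D := D) hΓ hΓc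
  obtain ⟨u, hum, hu⟩ := exists_measurable_argmin
    (fun p q : stdSimplex ℝ (Fin d) => γ * Real.log (decay c h p.1 q.1) + Γ v q)
    (hD.add ((Γ v).continuous.comp continuous_snd))
  have hvle : ∀ p q : stdSimplex ℝ (Fin d),
      v p + lam ≤ γ * Real.log (decay c h p.1 q.1) + Γ v q := fun p q => by
    rw [hv p]
    exact ciInf_le (bddBelow_range_of_compactSpace (D p + Γ v)) q
  refine ⟨v, Γ v, lam, fun q => ?_, hvle, u, hum, fun p => le_antisymm (hvle p (u p)) ?_⟩
  · rw [hΓe, ofReal_integral_eq_lintegral_ofReal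
      (integrable_growthKernel hγ hw hpos hint v q.2)
      (ae_of_all _ fun ω => (Real.exp_pos _).le)]
  · rw [hv p]
    exact le_ciInf fun q => hu p q

end Growth

/-! ### Wealth and weights of a self-financing position -/

theorem tradingCost_smul (c h x : Fin d → ℝ) {a : ℝ} (ha : 0 ≤ a) :
    tradingCost c h (a • x) = a * tradingCost c h x := by
  unfold tradingCost
  rw [Finset.mul_sum]
  refine Finset.sum_congr rfl fun i _ => ?_
  have h1 : max (a * x i) 0 = a * max (x i) 0 := by rw [mul_max_of_nonneg _ _ ha, mul_zero]
  have h2 : max (-(a * x i)) 0 = a * max (-x i) 0 := by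
    rw [mul_max_of_nonneg _ _ ha, mul_zero, mul_neg]
  simp only [Pi.smul_apply, smul_eq_mul, h1, h2]
  ring

theorem div_sum_mem_stdSimplex {a : Fin d → ℝ} (ha : ∀ i, 0 ≤ a i) (hpos : 0 < ∑ i, a i) :
    (fun i => a i / ∑ j, a j) ∈ stdSimplex ℝ (Fin d) := by
  refine ⟨fun i => div_nonneg (ha i) hpos.le, ?_⟩
  simp only
  rw [← Finset.sum_div, div_self hpos.ne']

/-- Proportional costs with rates below one cannot exhaust the wealth. Here `a` and `b` are the
amounts invested in the assets before and after the rebalancing. -/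
theorem sum_pos_of_selfFinancing {c h : Fin d → ℝ} (hh : ∀ i, 0 < h i ∧ h i < 1)
    {a b : Fin d → ℝ} (ha : ∀ i, 0 ≤ a i) (hb : ∀ i, 0 ≤ b i) (hpos : 0 < ∑ i, a i)
    (hsf : ∑ i, b i = ∑ i, a i - tradingCost c h (b - a)) : 0 < ∑ i, b i := by
  refine (Finset.sum_nonneg fun i _ => hb i).lt_of_ne' fun h0 => ?_
  have hb0 : b = 0 := by
    funext i
    exact (Finset.sum_eq_zero_iff_of_nonneg fun j _ => hb j).1 h0 i (Finset.mem_univ i)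
  have hcost : tradingCost c h (b - a) = ∑ i, h i * a i := by
    unfold tradingCost
    refine Finset.sum_congr rfl fun i _ => ?_
    simp [hb0, ha i]
  have hlt := sum_mul_lt_one hh (div_sum_mem_stdSimplex ha hpos)
  simp only [mul_div_assoc'] at hlt
  rw [← Finset.sum_div, div_lt_one hpos] at hlt
  linarith

theorem sum_eq_decay_mul {c h : Fin d → ℝ} (hc : ∀ i, 0 < c i ∧ c i < 1)
    (hh : ∀ i, 0 < h i ∧ h i < 1) {a b : Fin d → ℝ} (ha : ∀ i, 0 ≤ a i) (hb : ∀ i, 0 ≤ b i)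
    (hpos : 0 < ∑ i, a i) (hsf : ∑ i, b i = ∑ i, a i - tradingCost c h (b - a)) :
    ∑ i, b i =
      decay c h (fun i => a i / ∑ j, a j) (fun i => b i / ∑ j, b j) * ∑ i, a i := by
  have hbpos := sum_pos_of_selfFinancing hh ha hb hpos hsf
  rw [← ((decay_spec hc hh (div_sum_mem_stdSimplex ha hpos)
    (div_sum_mem_stdSimplex hb hbpos)).1 ((∑ i, b i) / ∑ i, a i)).1 ?_, div_mul_cancel₀ _ hpos.ne']
  have : ((∑ i, b i) / ∑ i, a i) • (fun i => b i / ∑ j, b j) - (fun i => a i / ∑ j, a j) =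
      (∑ i, a i)⁻¹ • (b - a) := by
    funext i
    simp only [Pi.sub_apply, Pi.smul_apply, smul_eq_mul]
    field_simp
  rw [this, tradingCost_smul _ _ _ (inv_nonneg.2 hpos.le)]
  field_simp
  linarith

/-- Moving to the target weights `q`, and scaling the wealth by the capital decay, is
self-financing. -/
theorem selfFinancing_of_decay {c h : Fin d → ℝ} (hc : ∀ i, 0 < c i ∧ c i < 1)
    (hh : ∀ i, 0 < h i ∧ h i < 1) {a q : Fin d → ℝ} (ha : ∀ i, 0 ≤ a i)
    (hpos : 0 < ∑ i, a i) (hq : q ∈ stdSimplex ℝ (Fin d)) :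
    decay c h (fun i => a i / ∑ j, a j) q * ∑ i, a i = ∑ i, a i -
      tradingCost c h ((decay c h (fun i => a i / ∑ j, a j) q * ∑ i, a i) • q - a) := by
  set s := decay c h (fun i => a i / ∑ j, a j) q with hs
  have hroot := ((decay_spec hc hh (div_sum_mem_stdSimplex ha hpos) hq).1 s).2 hs
  have : (s * ∑ i, a i) • q - a = (∑ i, a i) • (s • q - fun i => a i / ∑ j, a j) := by
    funext i
    simp only [Pi.sub_apply, Pi.smul_apply, smul_eq_mul]
    field_simp
  rw [this, tradingCost_smul _ _ _ hpos.le]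
  linear_combination (∑ i, a i) * hroot

section Wealth

variable {S : ℕ → Ω → Fin d → ℝ} {N₀ : Ω → Fin d → ℝ} {N : ℕ → Ω → Fin d → ℝ}

theorem preWealth_succ (hSpos : ∀ t ω i, 0 < S t ω i) {t : ℕ} {ω : Ω}
    (hpos : 0 < postWealth S N t ω) :
    preWealth S N₀ N (t + 1) ω =
      postWealth S N t ω * ∑ i, postWeights S N t ω i * priceRatio S t ω i := by
  rw [Finset.mul_sum]
  refine Finset.sum_congr rfl fun i _ => ?_
  have := (hSpos t ω i).ne'
  have := hpos.ne'
  simp only [preHoldings, postWeights, priceRatio]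
  field_simp

theorem preWeights_succ (hSpos : ∀ t ω i, 0 < S t ω i) {t : ℕ} {ω : Ω}
    (hpos : 0 < postWealth S N t ω) :
    preWeights S N₀ N (t + 1) ω = drift (postWeights S N t ω) (priceRatio S t ω) := by
  funext i
  have h1 := (hSpos t ω i).ne'
  have h2 := hpos.ne'
  simp only [preWeights, drift]
  rw [preWealth_succ hSpos hpos]
  simp only [preHoldings, priceRatio]
  rw [← div_div]
  congr 1
  simp only [postWeights]
  field_simp

theorem priceRatio_pos (hSpos : ∀ t ω i, 0 < S t ω i) (t : ℕ) (ω : Ω) (i : Fin d) :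
    0 < priceRatio S t ω i :=
  div_pos (hSpos _ _ _) (hSpos _ _ _)

theorem exp_logReturn (hSpos : ∀ t ω i, 0 < S t ω i) (t : ℕ) (ω : Ω) :
    (fun i => Real.exp (logReturn S t ω i)) = priceRatio S t ω :=
  funext fun i => Real.exp_log (priceRatio_pos hSpos t ω i)

variable [MeasurableSpace Ω] {ℱ : Filtration ℕ ‹MeasurableSpace Ω›} {c h : Fin d → ℝ}

theorem IsTradingStrategy.preHoldings_nonneg (hN₀ : IsEndowment ℱ S N₀)
    (hN : IsTradingStrategy ℱ S c h N₀ N) (t : ℕ) (ω : Ω) (i : Fin d) :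
    0 ≤ preHoldings N₀ N t ω i := by
  cases t with
  | zero => exact hN₀.nonneg ω i
  | succ t => exact hN.nonneg t ω i

theorem preWealth_zero_pos (hN₀ : IsEndowment ℱ S N₀) (ω : Ω) : 0 < preWealth S N₀ N 0 ω := by
  obtain ⟨x, hx, hxω⟩ := hN₀.wealth
  exact hx.trans_eq (hxω ω).symm

theorem IsTradingStrategy.sum_eq (hN : IsTradingStrategy ℱ S c h N₀ N) (t : ℕ) (ω : Ω) :
    ∑ i, N t ω i * S t ω i = ∑ i, preHoldings N₀ N t ω i * S t ω i -
      tradingCost c h ((fun i => N t ω i * S t ω i) -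
        fun i => preHoldings N₀ N t ω i * S t ω i) := by
  have := hN.selfFinancing t ω
  simp only [sub_mul] at this
  exact this

theorem IsTradingStrategy.preWealth_pos (hSpos : ∀ t ω i, 0 < S t ω i)
    (hh : ∀ i, 0 < h i ∧ h i < 1) (hN₀ : IsEndowment ℱ S N₀)
    (hN : IsTradingStrategy ℱ S c h N₀ N) (t : ℕ) (ω : Ω) : 0 < preWealth S N₀ N t ω := by
  induction t with
  | zero => exact preWealth_zero_pos hN₀ ω
  | succ t ih =>
    have hN1 : ∀ i, 0 ≤ N t ω i * S t ω i := fun i =>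
      mul_nonneg (hN.nonneg t ω i) (hSpos t ω i).le
    have hpost : 0 < postWealth S N t ω := sum_pos_of_selfFinancing hh
      (fun i => mul_nonneg (hN.preHoldings_nonneg hN₀ t ω i) (hSpos t ω i).le) hN1 ih
      (hN.sum_eq t ω)
    rw [preWealth_succ hSpos hpost]
    exact mul_pos hpost (sum_mul_pos_of_mem_stdSimplex (div_sum_mem_stdSimplex hN1 hpost)
      (priceRatio_pos hSpos t ω))

theorem IsTradingStrategy.postWealth_pos (hSpos : ∀ t ω i, 0 < S t ω i)
    (hh : ∀ i, 0 < h i ∧ h i < 1) (hN₀ : IsEndowment ℱ S N₀)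
    (hN : IsTradingStrategy ℱ S c h N₀ N) (t : ℕ) (ω : Ω) : 0 < postWealth S N t ω :=
  sum_pos_of_selfFinancing hh
    (fun i => mul_nonneg (hN.preHoldings_nonneg hN₀ t ω i) (hSpos t ω i).le)
    (fun i => mul_nonneg (hN.nonneg t ω i) (hSpos t ω i).le)
    (hN.preWealth_pos hSpos hh hN₀ t ω) (hN.sum_eq t ω)

theorem IsTradingStrategy.preWeights_mem (hSpos : ∀ t ω i, 0 < S t ω i)
    (hh : ∀ i, 0 < h i ∧ h i < 1) (hN₀ : IsEndowment ℱ S N₀)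
    (hN : IsTradingStrategy ℱ S c h N₀ N) (t : ℕ) (ω : Ω) :
    preWeights S N₀ N t ω ∈ stdSimplex ℝ (Fin d) :=
  div_sum_mem_stdSimplex
    (fun i => mul_nonneg (hN.preHoldings_nonneg hN₀ t ω i) (hSpos t ω i).le)
    (hN.preWealth_pos hSpos hh hN₀ t ω)

theorem IsTradingStrategy.postWeights_mem (hSpos : ∀ t ω i, 0 < S t ω i)
    (hh : ∀ i, 0 < h i ∧ h i < 1) (hN₀ : IsEndowment ℱ S N₀)
    (hN : IsTradingStrategy ℱ S c h N₀ N) (t : ℕ) (ω : Ω) :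
    postWeights S N t ω ∈ stdSimplex ℝ (Fin d) :=
  div_sum_mem_stdSimplex (fun i => mul_nonneg (hN.nonneg t ω i) (hSpos t ω i).le)
    (hN.postWealth_pos hSpos hh hN₀ t ω)

theorem IsTradingStrategy.postWealth_eq (hSpos : ∀ t ω i, 0 < S t ω i)
    (hc : ∀ i, 0 < c i ∧ c i < 1) (hh : ∀ i, 0 < h i ∧ h i < 1) (hN₀ : IsEndowment ℱ S N₀)
    (hN : IsTradingStrategy ℱ S c h N₀ N) (t : ℕ) (ω : Ω) :
    postWealth S N t ω = decay c h (preWeights S N₀ N t ω) (postWeights S N t ω) *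
      preWealth S N₀ N t ω :=
  sum_eq_decay_mul hc hh
    (fun i => mul_nonneg (hN.preHoldings_nonneg hN₀ t ω i) (hSpos t ω i).le)
    (fun i => mul_nonneg (hN.nonneg t ω i) (hSpos t ω i).le)
    (hN.preWealth_pos hSpos hh hN₀ t ω) (hN.sum_eq t ω)

end Wealth

/-! ### The strategy that follows a selector -/

/-- Holdings after rebalancing to the weights `u p`, where `p` are the current weights and `σ p` is
the fraction of the wealth that is left. The argument is the pair of holdings and prices, and the
decay enters as a function `σ` of its own so that it can be taken Borel on the whole space. -/
noncomputable def rebalance (σ : (Fin d → ℝ) → ℝ) (u : (Fin d → ℝ) → Fin d → ℝ)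
    (z : (Fin d → ℝ) × (Fin d → ℝ)) : Fin d → ℝ :=
  fun i => σ (fun j => z.1 j * z.2 j / ∑ k, z.1 k * z.2 k) * (∑ k, z.1 k * z.2 k) *
    u (fun j => z.1 j * z.2 j / ∑ k, z.1 k * z.2 k) i / z.2 i

/-- The holdings obtained by rebalancing to the weights prescribed by `u` in every period. -/
noncomputable def selectorHoldings (σ : (Fin d → ℝ) → ℝ) (u : (Fin d → ℝ) → Fin d → ℝ)
    (S : ℕ → Ω → Fin d → ℝ) (N₀ : Ω → Fin d → ℝ) : ℕ → Ω → Fin d → ℝ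
  | 0 => fun ω => rebalance σ u (N₀ ω, S 0 ω)
  | t + 1 => fun ω => rebalance σ u (selectorHoldings σ u S N₀ t ω, S (t + 1) ω)

theorem selectorHoldings_eq (σ : (Fin d → ℝ) → ℝ) (u : (Fin d → ℝ) → Fin d → ℝ)
    (S : ℕ → Ω → Fin d → ℝ) (N₀ : Ω → Fin d → ℝ) (t : ℕ) (ω : Ω) :
    selectorHoldings σ u S N₀ t ω =
      rebalance σ u (preHoldings N₀ (selectorHoldings σ u S N₀) t ω, S t ω) := by
  cases t <;> rfl

theorem measurable_rebalance {σ : (Fin d → ℝ) → ℝ} {u : (Fin d → ℝ) → Fin d → ℝ}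
    (hσ : Measurable σ) (hu : Measurable u) : Measurable (rebalance σ u) := by
  have hp : Measurable fun z : (Fin d → ℝ) × (Fin d → ℝ) =>
      fun j => z.1 j * z.2 j / ∑ k, z.1 k * z.2 k := by fun_prop
  have h1 := hσ.comp hp
  have h2 := hu.comp hp
  refine measurable_pi_iff.2 fun i => ?_
  have h3 := (measurable_pi_apply i).comp h2
  exact ((h1.mul (by fun_prop)).mul h3).div (by fun_prop)

/-- Along a measurable selector the capital decay agrees on the simplex with a Borel function. -/
theorem exists_measurable_decay {c h : Fin d → ℝ} (hc : ∀ i, 0 < c i ∧ c i < 1)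
    (hh : ∀ i, 0 < h i ∧ h i < 1) {u : (Fin d → ℝ) → Fin d → ℝ} (hu : Measurable u)
    (hmem : ∀ p ∈ stdSimplex ℝ (Fin d), u p ∈ stdSimplex ℝ (Fin d)) :
    ∃ σ : (Fin d → ℝ) → ℝ, Measurable σ ∧
      ∀ p ∈ stdSimplex ℝ (Fin d), σ p = decay c h p (u p) := by
  have hpair : Measurable fun p : stdSimplex ℝ (Fin d) =>
      (p, (⟨u p.1, hmem p.1 p.2⟩ : stdSimplex ℝ (Fin d))) :=
    measurable_id.prodMk (Measurable.subtype_mk (hu.comp measurable_subtype_coe))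
  have hm : Measurable fun p : stdSimplex ℝ (Fin d) => decay c h p.1 (u p.1) := by
    have hcomp := (measurable_decay hc hh).comp hpair
    simp only [Function.comp_def] at hcomp
    exact hcomp
  exact ⟨Function.extend Subtype.val (fun p : stdSimplex ℝ (Fin d) => decay c h p.1 (u p.1)) 0,
    (MeasurableEmbedding.subtype_coe
      (isClosed_stdSimplex ℝ (Fin d)).measurableSet).measurable_extend hm measurable_zero,
    fun p hp => Subtype.val_injective.extend_apply _ _ ⟨p, hp⟩⟩

/-- Every Borel choice of target weights is followed by some trading strategy. -/
theorem exists_tradingStrategy_of_selector [MeasurableSpace Ω]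
    {ℱ : Filtration ℕ ‹MeasurableSpace Ω›} {c h : Fin d → ℝ} (hc : ∀ i, 0 < c i ∧ c i < 1)
    (hh : ∀ i, 0 < h i ∧ h i < 1) {S : ℕ → Ω → Fin d → ℝ} (hSpos : ∀ t ω i, 0 < S t ω i)
    (hSmeas : ∀ t, Measurable[ℱ t] (S t)) {N₀ : Ω → Fin d → ℝ} (hN₀ : IsEndowment ℱ S N₀)
    {u : (Fin d → ℝ) → Fin d → ℝ} (hu : Measurable u)
    (hmem : ∀ p ∈ stdSimplex ℝ (Fin d), u p ∈ stdSimplex ℝ (Fin d)) :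
    ∃ N, IsTradingStrategy ℱ S c h N₀ N ∧
      ∀ t ω, postWeights S N t ω = u (preWeights S N₀ N t ω) := by
  obtain ⟨σ, hσ, hσeq⟩ := exists_measurable_decay hc hh hu hmem
  set N := selectorHoldings σ u S N₀ with hNdef
  have hstep : ∀ t ω, 0 < preWealth S N₀ N t ω → (∀ i, 0 ≤ preHoldings N₀ N t ω i) →
      u (preWeights S N₀ N t ω) ∈ stdSimplex ℝ (Fin d) ∧
      0 < decay c h (preWeights S N₀ N t ω) (u (preWeights S N₀ N t ω)) ∧
      ∀ i, N t ω i * S t ω i =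
        decay c h (preWeights S N₀ N t ω) (u (preWeights S N₀ N t ω)) * preWealth S N₀ N t ω *
          u (preWeights S N₀ N t ω) i := by
    intro t ω hpos hnn
    have hp : preWeights S N₀ N t ω ∈ stdSimplex ℝ (Fin d) :=
      div_sum_mem_stdSimplex (fun i => mul_nonneg (hnn i) (hSpos t ω i).le) hpos
    refine ⟨hmem _ hp, (decay_spec hc hh hp (hmem _ hp)).2.1, fun i => ?_⟩
    rw [← hσeq _ hp, hNdef, selectorHoldings_eq, ← hNdef]
    exact div_mul_cancel₀ _ (hSpos t ω i).ne'
  have hsum : ∀ t ω, 0 < preWealth S N₀ N t ω → (∀ i, 0 ≤ preHoldings N₀ N t ω i) →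
      postWealth S N t ω = decay c h (preWeights S N₀ N t ω) (u (preWeights S N₀ N t ω)) *
        preWealth S N₀ N t ω := by
    intro t ω hpos hnn
    obtain ⟨h1, -, h3⟩ := hstep t ω hpos hnn
    rw [postWealth, Finset.sum_congr rfl fun i _ => h3 i, ← Finset.mul_sum, h1.2, mul_one]
  have hnonneg : ∀ t ω, 0 < preWealth S N₀ N t ω → (∀ i, 0 ≤ preHoldings N₀ N t ω i) →
      ∀ i, 0 ≤ N t ω i := by
    intro t ω hpos hnn i
    obtain ⟨h1, h2, h3⟩ := hstep t ω hpos hnn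
    refine nonneg_of_mul_nonneg_left ?_ (hSpos t ω i)
    rw [h3 i]
    exact mul_nonneg (mul_pos h2 hpos).le (h1.1 i)
  have hinv : ∀ t ω, 0 < preWealth S N₀ N t ω ∧ ∀ i, 0 ≤ preHoldings N₀ N t ω i := by
    intro t ω
    induction t with
    | zero => exact ⟨preWealth_zero_pos hN₀ ω, hN₀.nonneg ω⟩
    | succ t ih =>
      have hN1 := hnonneg t ω ih.1 ih.2
      have hpost : 0 < postWealth S N t ω := by
        rw [hsum t ω ih.1 ih.2]
        exact mul_pos (hstep t ω ih.1 ih.2).2.1 ih.1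
      refine ⟨?_, hN1⟩
      rw [preWealth_succ hSpos hpost]
      exact mul_pos hpost (sum_mul_pos_of_mem_stdSimplex (div_sum_mem_stdSimplex
        (fun i => mul_nonneg (hN1 i) (hSpos t ω i).le) hpost) (priceRatio_pos hSpos t ω))
  refine ⟨N, ⟨fun t => ?_, fun t ω => hnonneg t ω (hinv t ω).1 (hinv t ω).2, fun t ω => ?_⟩,
    fun t ω => ?_⟩
  · induction t with
    | zero => exact (measurable_rebalance hσ hu).comp (hN₀.measurable.prodMk (hSmeas 0))
    | succ t ih =>
      exact (measurable_rebalance hσ hu).comp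
        ((ih.mono (ℱ.mono t.le_succ) le_rfl).prodMk (hSmeas (t + 1)))
  · obtain ⟨hpos, hnn⟩ := hinv t ω
    obtain ⟨h1, h2, h3⟩ := hstep t ω hpos hnn
    have hsf := selfFinancing_of_decay hc hh
      (fun i => mul_nonneg (hnn i) (hSpos t ω i).le) hpos h1
    have hx : (fun i => (N t ω i - preHoldings N₀ N t ω i) * S t ω i) =
        (decay c h (preWeights S N₀ N t ω) (u (preWeights S N₀ N t ω)) *
          preWealth S N₀ N t ω) • u (preWeights S N₀ N t ω) -
            fun i => preHoldings N₀ N t ω i * S t ω i := by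
      funext i
      rw [sub_mul, h3 i]
      rfl
    rw [hsum t ω hpos hnn, hx]
    exact hsf
  · obtain ⟨hpos, hnn⟩ := hinv t ω
    obtain ⟨-, h2, h3⟩ := hstep t ω hpos hnn
    funext i
    rw [postWeights, h3 i, hsum t ω hpos hnn, mul_div_cancel_left₀ _ (mul_pos h2 hpos).ne']

/-! ### Entropic utility -/

section Entropic

variable [MeasurableSpace Ω] {P : Measure Ω} {γ : ℝ} {X : Ω → ℝ}

theorem antitone_coe_mul_log {a : ℝ} (ha : a < 0) :
    Antitone fun x : ENNReal => (a : EReal) * ENNReal.log x := by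
  intro x y hxy
  have h1 : ((-a : ℝ) : EReal) * ENNReal.log x ≤ ((-a : ℝ) : EReal) * ENNReal.log y :=
    mul_le_mul_of_nonneg_left (ENNReal.log_monotone hxy)
      (EReal.coe_nonneg.2 (neg_nonneg.2 ha.le))
  simp only [EReal.coe_neg, EReal.neg_mul] at h1
  exact EReal.neg_le_neg_iff.1 h1

theorem coe_mul_log_ofReal_exp (a y : ℝ) :
    (a : EReal) * ENNReal.log (ENNReal.ofReal (Real.exp y)) = ((a * y : ℝ) : EReal) := by
  rw [ENNReal.log_ofReal_of_pos (Real.exp_pos y), Real.log_exp, EReal.coe_mul]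

theorem entropicUtility_le (hγ : γ < 0) {y : ℝ}
    (hy : ENNReal.ofReal (Real.exp y) ≤ ∫⁻ ω, ENNReal.ofReal (Real.exp (γ * X ω)) ∂P) :
    entropicUtility P γ X ≤ ((γ⁻¹ * y : ℝ) : EReal) := by
  rw [← coe_mul_log_ofReal_exp]
  exact antitone_coe_mul_log (inv_lt_zero.2 hγ) hy

theorem le_entropicUtility (hγ : γ < 0) {y : ℝ}
    (hy : ∫⁻ ω, ENNReal.ofReal (Real.exp (γ * X ω)) ∂P ≤ ENNReal.ofReal (Real.exp y)) :
    ((γ⁻¹ * y : ℝ) : EReal) ≤ entropicUtility P γ X := by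
  rw [← coe_mul_log_ofReal_exp]
  exact antitone_coe_mul_log (inv_lt_zero.2 hγ) hy

theorem tendsto_inv_mul_div (γ lam a : ℝ) :
    Tendsto (fun n : ℕ => ((γ⁻¹ * (n * lam + a) : ℝ) : EReal) / (n : EReal)) atTop
      (𝓝 ((lam / γ : ℝ) : EReal)) := by
  have h1 : Tendsto (fun n : ℕ => γ⁻¹ * lam + γ⁻¹ * a / (n : ℝ)) atTop (𝓝 (γ⁻¹ * lam + 0)) :=
    tendsto_const_nhds.add (tendsto_const_div_atTop_nhds_zero_nat _)
  have h2 : γ⁻¹ * lam + 0 = lam / γ := by ring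
  rw [h2] at h1
  refine ((continuous_coe_real_ereal.tendsto _).comp h1).congr' ?_
  filter_upwards [eventually_gt_atTop 0] with n hn
  have hn' : (n : ℝ) ≠ 0 := Nat.cast_ne_zero.2 hn.ne'
  have h3 : ((n : ℕ) : EReal) = ((n : ℝ) : EReal) := rfl
  rw [h3, ← EReal.coe_div, Function.comp_apply]
  congr 1
  field_simp

/-- A lower bound of exponential order on the moments bounds the long-run value from above, since
the exponent is negative. -/
theorem longRunValue_le (hγ : γ < 0) {S : ℕ → Ω → Fin d → ℝ} {N₀ : Ω → Fin d → ℝ}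
    {N : ℕ → Ω → Fin d → ℝ} {lam a : ℝ}
    (H : ∀ n : ℕ, ENNReal.ofReal (Real.exp (n * lam + a)) ≤
      ∫⁻ ω, ENNReal.ofReal (Real.exp (γ * Real.log (preWealth S N₀ N n ω))) ∂P) :
    longRunValue P γ S N₀ N ≤ ((lam / γ : ℝ) : EReal) := by
  rw [← (tendsto_inv_mul_div γ lam a).liminf_eq]
  exact liminf_le_liminf (Eventually.of_forall fun n =>
    EReal.div_le_div_right_of_nonneg (by positivity) (entropicUtility_le hγ (H n)))

theorem le_longRunValue (hγ : γ < 0) {S : ℕ → Ω → Fin d → ℝ} {N₀ : Ω → Fin d → ℝ}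
    {N : ℕ → Ω → Fin d → ℝ} {lam a : ℝ}
    (H : ∀ n : ℕ, ∫⁻ ω, ENNReal.ofReal (Real.exp (γ * Real.log (preWealth S N₀ N n ω))) ∂P ≤
      ENNReal.ofReal (Real.exp (n * lam + a))) :
    ((lam / γ : ℝ) : EReal) ≤ longRunValue P γ S N₀ N := by
  rw [← (tendsto_inv_mul_div γ lam a).liminf_eq]
  exact liminf_le_liminf (Eventually.of_forall fun n =>
    EReal.div_le_div_right_of_nonneg (by positivity) (le_entropicUtility hγ (H n)))

/-- On the simplex the Bellman objective is the rebalancing cost plus the logarithmic growth. -/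
theorem bellmanObjective_eq (hγ : γ < 0) {w : Ω → Fin d → ℝ} {c h : Fin d → ℝ}
    {v g : C(stdSimplex ℝ (Fin d), ℝ)}
    (hg : ∀ q : stdSimplex ℝ (Fin d),
      ∫⁻ ω, ENNReal.ofReal (growthKernel γ (extendByZero v) q.1 (w ω)) ∂P =
        ENNReal.ofReal (Real.exp (g q)))
    (p q : stdSimplex ℝ (Fin d)) :
    bellmanObjective P γ w c h (extendByZero v) p.1 q.1 =
      ((γ⁻¹ * (γ * Real.log (decay c h p.1 q.1) + g q) : ℝ) : EReal) := by
  rw [← coe_mul_log_ofReal_exp, bellmanObjective, entropicUtility]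
  congr 2
  rw [Real.exp_add, ENNReal.ofReal_mul (Real.exp_pos _).le, ← hg q,
    ← lintegral_const_mul' _ _ ENNReal.ofReal_ne_top]
  refine lintegral_congr fun ω => ?_
  rw [← ENNReal.ofReal_mul (Real.exp_pos _).le, growthKernel, ← Real.exp_add]
  congr 2
  rw [mul_add, mul_inv_cancel_left₀ hγ.ne]
  ring

end Entropic

/-! ### Verification -/

/-- If `R` is independent of the information on which `X` depends, then `X` can be frozen in the
expectation of a function of both, and `R` can be replaced by a copy. -/
theorem lintegral_comp_of_indep {α β : Type*} [MeasurableSpace α] [MeasurableSpace β]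
    {m mΩ : MeasurableSpace Ω} {P : Measure Ω} [IsProbabilityMeasure P] (hm : m ≤ mΩ) {X : Ω → α}
    (hX : Measurable[m] X) {R R' : Ω → β} (hR : IdentDistrib R R' P P)
    (hind : Indep (MeasurableSpace.comap R inferInstance) m P) {Φ : α × β → ENNReal}
    (hΦ : Measurable Φ) :
    ∫⁻ ω, Φ (X ω, R ω) ∂P = ∫⁻ ω, ∫⁻ ω', Φ (X ω, R' ω') ∂P ∂P := by
  have hXm : Measurable X := hX.mono hm le_rfl
  have hXR : IndepFun X R P := (indep_of_indep_of_le_right hind hX.comap_le).symm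
  have hmap := (indepFun_iff_map_prod_eq_prod_map_map hXm.aemeasurable
    hR.aemeasurable_fst).1 hXR
  rw [← lintegral_map' hΦ.aemeasurable (hXm.aemeasurable.prodMk hR.aemeasurable_fst), hmap,
    hR.map_eq]
  have : IsProbabilityMeasure (P.map R') := Measure.isProbabilityMeasure_map hR.aemeasurable_snd
  rw [lintegral_prod _ hΦ.aemeasurable, lintegral_map hΦ.lintegral_prod_right' hXm]
  refine lintegral_congr fun ω => ?_
  exact lintegral_map' (hΦ.comp measurable_prodMk_left).aemeasurable hR.aemeasurable_snd

section Verification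

variable [MeasurableSpace Ω] {P : Measure Ω}
  {ℱ : Filtration ℕ ‹MeasurableSpace Ω›} {c h : Fin d → ℝ} {S : ℕ → Ω → Fin d → ℝ}
  {γ lam : ℝ} {v g : C(stdSimplex ℝ (Fin d), ℝ)} {N₀ : Ω → Fin d → ℝ} {N : ℕ → Ω → Fin d → ℝ}

/-- The expectation of `W(t-) ^ γ * exp (v (π(t-)))`. -/
noncomputable def weightedMoment (P : Measure Ω) (γ : ℝ) (v : C(stdSimplex ℝ (Fin d), ℝ))
    (S : ℕ → Ω → Fin d → ℝ) (N₀ : Ω → Fin d → ℝ) (N : ℕ → Ω → Fin d → ℝ) (t : ℕ) : ENNReal :=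
  ∫⁻ ω, ENNReal.ofReal (Real.exp (γ * Real.log (preWealth S N₀ N t ω) +
    extendByZero v (preWeights S N₀ N t ω))) ∂P

theorem weightedMoment_le_mul (hSpos : ∀ t ω i, 0 < S t ω i) (hh : ∀ i, 0 < h i ∧ h i < 1)
    (hN₀ : IsEndowment ℱ S N₀) (hN : IsTradingStrategy ℱ S c h N₀ N) (t : ℕ) :
    weightedMoment P γ v S N₀ N t ≤ ENNReal.ofReal (Real.exp ‖v‖) *
      ∫⁻ ω, ENNReal.ofReal (Real.exp (γ * Real.log (preWealth S N₀ N t ω))) ∂P := by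
  rw [weightedMoment, ← lintegral_const_mul' _ _ ENNReal.ofReal_ne_top]
  refine lintegral_mono fun ω => ?_
  rw [← ENNReal.ofReal_mul (Real.exp_pos _).le, ← Real.exp_add]
  refine ENNReal.ofReal_le_ofReal (Real.exp_le_exp.2 ?_)
  linarith [(abs_le.1 (abs_extendByZero_le v (hN.preWeights_mem hSpos hh hN₀ t ω))).2]

theorem lintegral_le_mul_weightedMoment (hSpos : ∀ t ω i, 0 < S t ω i)
    (hh : ∀ i, 0 < h i ∧ h i < 1)
    (hN₀ : IsEndowment ℱ S N₀) (hN : IsTradingStrategy ℱ S c h N₀ N) (t : ℕ) :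
    ∫⁻ ω, ENNReal.ofReal (Real.exp (γ * Real.log (preWealth S N₀ N t ω))) ∂P ≤
      ENNReal.ofReal (Real.exp ‖v‖) * weightedMoment P γ v S N₀ N t := by
  rw [weightedMoment, ← lintegral_const_mul' _ _ ENNReal.ofReal_ne_top]
  refine lintegral_mono fun ω => ?_
  rw [← ENNReal.ofReal_mul (Real.exp_pos _).le, ← Real.exp_add]
  refine ENNReal.ofReal_le_ofReal (Real.exp_le_exp.2 ?_)
  linarith [(abs_le.1 (abs_extendByZero_le v (hN.preWeights_mem hSpos hh hN₀ t ω))).1]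

variable [IsProbabilityMeasure P]

theorem lintegral_preWealth_zero {x : ℝ} (hx : ∀ ω, ∑ i, N₀ ω i * S 0 ω i = x) :
    ∫⁻ ω, ENNReal.ofReal (Real.exp (γ * Real.log (preWealth S N₀ N 0 ω))) ∂P =
      ENNReal.ofReal (Real.exp (γ * Real.log x)) := by
  have : ∀ ω, preWealth S N₀ N 0 ω = x := hx
  simp [this]

/-- One period of the controlled dynamics: the price change is independent of the wealth and the
weights after the rebalancing, so integrating it out replaces the growth kernel by `exp g`. -/
theorem weightedMoment_succ (hc : ∀ i, 0 < c i ∧ c i < 1) (hh : ∀ i, 0 < h i ∧ h i < 1)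
    (hSpos : ∀ t ω i, 0 < S t ω i) (hSmeas : ∀ t, Measurable[ℱ t] (S t))
    (hident : ∀ t, IdentDistrib (logReturn S t) (logReturn S 0) P P)
    (hindep : ∀ t, Indep (MeasurableSpace.comap (logReturn S t) inferInstance) (ℱ t) P)
    (hg : ∀ q : stdSimplex ℝ (Fin d),
      ∫⁻ ω, ENNReal.ofReal (growthKernel γ (extendByZero v) q.1 (priceRatio S 0 ω)) ∂P =
        ENNReal.ofReal (Real.exp (g q)))
    (hN₀ : IsEndowment ℱ S N₀) (hN : IsTradingStrategy ℱ S c h N₀ N) (t : ℕ) :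
    weightedMoment P γ v S N₀ N (t + 1) =
      ∫⁻ ω, ENNReal.ofReal (Real.exp (γ * Real.log (preWealth S N₀ N t ω) +
        (γ * Real.log (decay c h (preWeights S N₀ N t ω) (postWeights S N t ω)) +
          g ⟨postWeights S N t ω, hN.postWeights_mem hSpos hh hN₀ t ω⟩))) ∂P := by
  have hW : Measurable[ℱ t] (postWealth S N t) := by
    unfold postWealth
    exact Finset.measurable_fun_sum _ fun i _ =>
      ((measurable_pi_apply i).comp (hN.measurable t)).mul
        ((measurable_pi_apply i).comp (hSmeas t))
  have hQ : Measurable[ℱ t] (postWeights S N t) :=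
    @measurable_pi_lambda _ _ _ (ℱ t) _ _ fun i =>
      (((measurable_pi_apply i).comp (hN.measurable t)).mul
        ((measurable_pi_apply i).comp (hSmeas t))).div hW
  set Φ : (ℝ × (Fin d → ℝ)) × (Fin d → ℝ) → ENNReal := fun z =>
    ENNReal.ofReal (Real.exp (γ * Real.log z.1.1)) *
      ENNReal.ofReal (growthKernel γ (extendByZero v) z.1.2 fun i => Real.exp (z.2 i)) with hΦdef
  have hΦ : Measurable Φ := by
    have h1 : Measurable fun z : (ℝ × (Fin d → ℝ)) × (Fin d → ℝ) =>
        (z.1.2, fun i => Real.exp (z.2 i)) := by fun_prop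
    have h2 := (measurable_growthKernel γ (measurable_extendByZero v)).comp h1
    have h3 : Measurable fun z : (ℝ × (Fin d → ℝ)) × (Fin d → ℝ) => γ * Real.log z.1.1 :=
      (Real.measurable_log.comp (by fun_prop)).const_mul γ
    exact (Real.measurable_exp.comp h3).ennreal_ofReal.mul h2.ennreal_ofReal
  have hfreeze := lintegral_comp_of_indep (ℱ.le t) (hW.prodMk hQ) (hident t) (hindep t) hΦ
  calc weightedMoment P γ v S N₀ N (t + 1)
      = ∫⁻ ω, Φ ((postWealth S N t ω, postWeights S N t ω), logReturn S t ω) ∂P := by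
        refine lintegral_congr fun ω => ?_
        have hpost := hN.postWealth_pos hSpos hh hN₀ t ω
        have hsum := sum_mul_pos_of_mem_stdSimplex (hN.postWeights_mem hSpos hh hN₀ t ω)
          (priceRatio_pos hSpos t ω)
        simp only [hΦdef, exp_logReturn hSpos t ω]
        rw [preWealth_succ hSpos hpost, preWeights_succ hSpos hpost, growthKernel,
          Real.log_mul hpost.ne' hsum.ne', ← ENNReal.ofReal_mul (Real.exp_pos _).le,
          ← Real.exp_add, mul_add, add_assoc]
    _ = ∫⁻ ω, ENNReal.ofReal (Real.exp (γ * Real.log (postWealth S N t ω))) *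
          ENNReal.ofReal (Real.exp
            (g ⟨postWeights S N t ω, hN.postWeights_mem hSpos hh hN₀ t ω⟩)) ∂P := by
        rw [hfreeze]
        refine lintegral_congr fun ω => ?_
        simp only [hΦdef, exp_logReturn hSpos 0]
        rw [lintegral_const_mul' _ _ ENNReal.ofReal_ne_top, ← hg]
    _ = _ := by
        refine lintegral_congr fun ω => ?_
        have hpre := hN.preWealth_pos hSpos hh hN₀ t ω
        have hdec := (decay_spec hc hh (hN.preWeights_mem hSpos hh hN₀ t ω)
          (hN.postWeights_mem hSpos hh hN₀ t ω)).2.1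
        rw [← ENNReal.ofReal_mul (Real.exp_pos _).le, ← Real.exp_add,
          hN.postWealth_eq hSpos hc hh hN₀ t ω, Real.log_mul hdec.ne' hpre.ne']
        congr 2
        ring

/-- By the Bellman inequality, `W(t-) ^ γ * exp (v (π(t-)) - t lam)` has nondecreasing expectation. -/
theorem mul_weightedMoment_le (hc : ∀ i, 0 < c i ∧ c i < 1) (hh : ∀ i, 0 < h i ∧ h i < 1)
    (hSpos : ∀ t ω i, 0 < S t ω i) (hSmeas : ∀ t, Measurable[ℱ t] (S t))
    (hident : ∀ t, IdentDistrib (logReturn S t) (logReturn S 0) P P)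
    (hindep : ∀ t, Indep (MeasurableSpace.comap (logReturn S t) inferInstance) (ℱ t) P)
    (hg : ∀ q : stdSimplex ℝ (Fin d),
      ∫⁻ ω, ENNReal.ofReal (growthKernel γ (extendByZero v) q.1 (priceRatio S 0 ω)) ∂P =
        ENNReal.ofReal (Real.exp (g q)))
    (hv : ∀ p q : stdSimplex ℝ (Fin d), v p + lam ≤ γ * Real.log (decay c h p.1 q.1) + g q)
    (hN₀ : IsEndowment ℱ S N₀) (hN : IsTradingStrategy ℱ S c h N₀ N) (t : ℕ) :
    ENNReal.ofReal (Real.exp (t * lam)) * weightedMoment P γ v S N₀ N 0 ≤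
      weightedMoment P γ v S N₀ N t := by
  induction t with
  | zero => simp
  | succ t ih =>
    have hstep : ENNReal.ofReal (Real.exp lam) * weightedMoment P γ v S N₀ N t ≤
        weightedMoment P γ v S N₀ N (t + 1) := by
      rw [weightedMoment_succ hc hh hSpos hSmeas hident hindep hg hN₀ hN t, weightedMoment,
        ← lintegral_const_mul' _ _ ENNReal.ofReal_ne_top]
      refine lintegral_mono fun ω => ?_
      rw [← ENNReal.ofReal_mul (Real.exp_pos _).le, ← Real.exp_add]
      refine ENNReal.ofReal_le_ofReal (Real.exp_le_exp.2 ?_)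
      rw [extendByZero_apply v (hN.preWeights_mem hSpos hh hN₀ t ω)]
      linarith [hv ⟨_, hN.preWeights_mem hSpos hh hN₀ t ω⟩
        ⟨_, hN.postWeights_mem hSpos hh hN₀ t ω⟩]
    refine le_trans (le_of_eq ?_) ((mul_le_mul_right ih _).trans hstep)
    rw [← mul_assoc, ← ENNReal.ofReal_mul (Real.exp_pos _).le, ← Real.exp_add]
    congr 3
    push_cast
    ring

/-- Along a selector the Bellman inequality is an equality, and the expectation of
`W(t-) ^ γ * exp (v (π(t-)) - t lam)` is constant. -/
theorem weightedMoment_eq_mul (hc : ∀ i, 0 < c i ∧ c i < 1) (hh : ∀ i, 0 < h i ∧ h i < 1)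
    (hSpos : ∀ t ω i, 0 < S t ω i) (hSmeas : ∀ t, Measurable[ℱ t] (S t))
    (hident : ∀ t, IdentDistrib (logReturn S t) (logReturn S 0) P P)
    (hindep : ∀ t, Indep (MeasurableSpace.comap (logReturn S t) inferInstance) (ℱ t) P)
    (hg : ∀ q : stdSimplex ℝ (Fin d),
      ∫⁻ ω, ENNReal.ofReal (growthKernel γ (extendByZero v) q.1 (priceRatio S 0 ω)) ∂P =
        ENNReal.ofReal (Real.exp (g q)))
    {u : (Fin d → ℝ) → Fin d → ℝ}
    (hv : ∀ p q : stdSimplex ℝ (Fin d), q.1 = u p.1 →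
      v p + lam = γ * Real.log (decay c h p.1 q.1) + g q)
    (hN₀ : IsEndowment ℱ S N₀) (hN : IsTradingStrategy ℱ S c h N₀ N)
    (hNu : ∀ t ω, postWeights S N t ω = u (preWeights S N₀ N t ω)) (t : ℕ) :
    weightedMoment P γ v S N₀ N t =
      ENNReal.ofReal (Real.exp (t * lam)) * weightedMoment P γ v S N₀ N 0 := by
  induction t with
  | zero => simp
  | succ t ih =>
    have hstep : weightedMoment P γ v S N₀ N (t + 1) =
        ENNReal.ofReal (Real.exp lam) * weightedMoment P γ v S N₀ N t := by
      rw [weightedMoment_succ hc hh hSpos hSmeas hident hindep hg hN₀ hN t, weightedMoment,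
        ← lintegral_const_mul' _ _ ENNReal.ofReal_ne_top]
      refine lintegral_congr fun ω => ?_
      rw [← ENNReal.ofReal_mul (Real.exp_pos _).le, ← Real.exp_add]
      congr 2
      rw [extendByZero_apply v (hN.preWeights_mem hSpos hh hN₀ t ω)]
      linarith [hv ⟨_, hN.preWeights_mem hSpos hh hN₀ t ω⟩
        ⟨_, hN.postWeights_mem hSpos hh hN₀ t ω⟩ (hNu t ω)]
    rw [hstep, ih, ← mul_assoc, ← ENNReal.ofReal_mul (Real.exp_pos _).le, ← Real.exp_add]
    congr 3
    push_cast
    ring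

/-- No strategy beats `lam / γ`: as `v` is bounded, its factor in the weighted moment vanishes on the
logarithmic scale. -/
theorem longRunValue_le_of_bellman (hγ : γ < 0) (hc : ∀ i, 0 < c i ∧ c i < 1)
    (hh : ∀ i, 0 < h i ∧ h i < 1)
    (hSpos : ∀ t ω i, 0 < S t ω i) (hSmeas : ∀ t, Measurable[ℱ t] (S t))
    (hident : ∀ t, IdentDistrib (logReturn S t) (logReturn S 0) P P)
    (hindep : ∀ t, Indep (MeasurableSpace.comap (logReturn S t) inferInstance) (ℱ t) P)
    (hg : ∀ q : stdSimplex ℝ (Fin d),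
      ∫⁻ ω, ENNReal.ofReal (growthKernel γ (extendByZero v) q.1 (priceRatio S 0 ω)) ∂P =
        ENNReal.ofReal (Real.exp (g q)))
    (hv : ∀ p q : stdSimplex ℝ (Fin d), v p + lam ≤ γ * Real.log (decay c h p.1 q.1) + g q)
    (hN₀ : IsEndowment ℱ S N₀) (hN : IsTradingStrategy ℱ S c h N₀ N) :
    longRunValue P γ S N₀ N ≤ ((lam / γ : ℝ) : EReal) := by
  obtain ⟨x, -, hx⟩ := hN₀.wealth
  refine longRunValue_le hγ (a := γ * Real.log x - 2 * ‖v‖) fun n => ?_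
  have h0 := lintegral_le_mul_weightedMoment (P := P) (γ := γ) (v := v) hSpos hh hN₀ hN 0
  rw [lintegral_preWealth_zero hx] at h0
  have h1 := mul_weightedMoment_le hc hh hSpos hSmeas hident hindep hg hv hN₀ hN n
  have h2 := weightedMoment_le_mul (P := P) (γ := γ) (v := v) hSpos hh hN₀ hN n
  set E := ∫⁻ ω, ENNReal.ofReal (Real.exp (γ * Real.log (preWealth S N₀ N n ω))) ∂P
  calc ENNReal.ofReal (Real.exp (n * lam + (γ * Real.log x - 2 * ‖v‖)))
      = ENNReal.ofReal (Real.exp (n * lam - 2 * ‖v‖)) *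
          ENNReal.ofReal (Real.exp (γ * Real.log x)) := by
        rw [← ENNReal.ofReal_mul (Real.exp_pos _).le, ← Real.exp_add]
        congr 2
        ring
    _ ≤ ENNReal.ofReal (Real.exp (n * lam - 2 * ‖v‖)) *
          (ENNReal.ofReal (Real.exp ‖v‖) * weightedMoment P γ v S N₀ N 0) := by gcongr
    _ = ENNReal.ofReal (Real.exp (-‖v‖)) *
          (ENNReal.ofReal (Real.exp (n * lam)) * weightedMoment P γ v S N₀ N 0) := by
        simp only [← mul_assoc]
        rw [← ENNReal.ofReal_mul (Real.exp_pos _).le, ← Real.exp_add,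
          ← ENNReal.ofReal_mul (Real.exp_pos _).le, ← Real.exp_add]
        congr 3
        ring
    _ ≤ ENNReal.ofReal (Real.exp (-‖v‖)) * (ENNReal.ofReal (Real.exp ‖v‖) * E) := by
        exact mul_le_mul_right (h1.trans h2) _
    _ = E := by
        rw [← mul_assoc, ← ENNReal.ofReal_mul (Real.exp_pos _).le, ← Real.exp_add]
        simp

theorem le_longRunValue_of_selector (hγ : γ < 0) (hc : ∀ i, 0 < c i ∧ c i < 1)
    (hh : ∀ i, 0 < h i ∧ h i < 1)
    (hSpos : ∀ t ω i, 0 < S t ω i) (hSmeas : ∀ t, Measurable[ℱ t] (S t))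
    (hident : ∀ t, IdentDistrib (logReturn S t) (logReturn S 0) P P)
    (hindep : ∀ t, Indep (MeasurableSpace.comap (logReturn S t) inferInstance) (ℱ t) P)
    (hg : ∀ q : stdSimplex ℝ (Fin d),
      ∫⁻ ω, ENNReal.ofReal (growthKernel γ (extendByZero v) q.1 (priceRatio S 0 ω)) ∂P =
        ENNReal.ofReal (Real.exp (g q)))
    {u : (Fin d → ℝ) → Fin d → ℝ}
    (hv : ∀ p q : stdSimplex ℝ (Fin d), q.1 = u p.1 →
      v p + lam = γ * Real.log (decay c h p.1 q.1) + g q)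
    (hN₀ : IsEndowment ℱ S N₀) (hN : IsTradingStrategy ℱ S c h N₀ N)
    (hNu : ∀ t ω, postWeights S N t ω = u (preWeights S N₀ N t ω)) :
    ((lam / γ : ℝ) : EReal) ≤ longRunValue P γ S N₀ N := by
  obtain ⟨x, -, hx⟩ := hN₀.wealth
  refine le_longRunValue hγ (a := γ * Real.log x + 2 * ‖v‖) fun n => ?_
  have h0 := weightedMoment_le_mul (P := P) (γ := γ) (v := v) hSpos hh hN₀ hN 0
  rw [lintegral_preWealth_zero hx] at h0
  have h1 := weightedMoment_eq_mul hc hh hSpos hSmeas hident hindep hg hv hN₀ hN hNu n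
  refine (lintegral_le_mul_weightedMoment (P := P) (γ := γ) (v := v) hSpos hh hN₀ hN n).trans ?_
  rw [h1]
  calc ENNReal.ofReal (Real.exp ‖v‖) *
        (ENNReal.ofReal (Real.exp (n * lam)) * weightedMoment P γ v S N₀ N 0)
      ≤ ENNReal.ofReal (Real.exp ‖v‖) * (ENNReal.ofReal (Real.exp (n * lam)) *
          (ENNReal.ofReal (Real.exp ‖v‖) * ENNReal.ofReal (Real.exp (γ * Real.log x)))) := by
        gcongr
    _ = ENNReal.ofReal (Real.exp (n * lam + (γ * Real.log x + 2 * ‖v‖))) := by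
        rw [← ENNReal.ofReal_mul (Real.exp_pos _).le, ← Real.exp_add,
          ← ENNReal.ofReal_mul (Real.exp_pos _).le, ← Real.exp_add,
          ← ENNReal.ofReal_mul (Real.exp_pos _).le, ← Real.exp_add]
        congr 2
        ring

end Verification

end Portfolio

theorem mainTheorem2 {Ω : Type*} [MeasurableSpace Ω] (P : Measure Ω) [IsProbabilityMeasure P]
    (ℱ : Filtration ℕ ‹MeasurableSpace Ω›)
    (d : ℕ) (hd : 0 < d)
    -- cost rates
    (c h : Fin d → ℝ) (hc : ∀ i, 0 < c i ∧ c i < 1) (hh : ∀ i, 0 < h i ∧ h i < 1)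
    -- positive adapted prices whose log-returns are i.i.d. with respect to the filtration
    (S : ℕ → Ω → Fin d → ℝ) (hSpos : ∀ t ω i, 0 < S t ω i) (hSmeas : ∀ t, Measurable[ℱ t] (S t))
    (hident : ∀ t, IdentDistrib (Portfolio.logReturn S t) (Portfolio.logReturn S 0) P P)
    (hindep : ∀ t, Indep (MeasurableSpace.comap (Portfolio.logReturn S t) inferInstance) (ℱ t) P)
    -- risk aversion, finite entropy and finite mean, mixing
    (γ : ℝ) (hγ : γ < 0)
    (hA1 : ∀ i, Integrable (fun ω => Real.exp (γ * Portfolio.logReturn S 0 ω i)) P ∧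
      Integrable (fun ω => Portfolio.logReturn S 0 ω i) P)
    (hA2 : Portfolio.Mixing P (Portfolio.priceRatio S 0)) :
    ∃ (lam : ℝ) (v : (Fin d → ℝ) → ℝ),
      ContinuousOn v (stdSimplex ℝ (Fin d)) ∧
      (∃ C : ℝ, ∀ p ∈ stdSimplex ℝ (Fin d), |v p| ≤ C) ∧
      -- the Bellman equation
      (∀ p ∈ stdSimplex ℝ (Fin d),
        ((v p + lam : ℝ) : EReal) = (γ : EReal) * ⨆ q ∈ stdSimplex ℝ (Fin d),
          Portfolio.bellmanObjective P γ (Portfolio.priceRatio S 0) c h v p q) ∧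
      -- the optimal value
      (∀ N₀, Portfolio.IsEndowment ℱ S N₀ →
        (⨆ N ∈ {N | Portfolio.IsTradingStrategy ℱ S c h N₀ N},
          Portfolio.longRunValue P γ S N₀ N) = ((lam / γ : ℝ) : EReal)) ∧
      -- selectors exist and determine optimal strategies
      (∃ u, Portfolio.IsBellmanSelector P γ (Portfolio.priceRatio S 0) c h v u) ∧
      (∀ u, Portfolio.IsBellmanSelector P γ (Portfolio.priceRatio S 0) c h v u →
        ∀ N₀, Portfolio.IsEndowment ℱ S N₀ →
          (∃ N, Portfolio.IsTradingStrategy ℱ S c h N₀ N ∧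
            ∀ t ω, Portfolio.postWeights S N t ω = u (Portfolio.preWeights S N₀ N t ω)) ∧
          (∀ N, Portfolio.IsTradingStrategy ℱ S c h N₀ N →
            (∀ t ω, Portfolio.postWeights S N t ω = u (Portfolio.preWeights S N₀ N t ω)) →
            Portfolio.longRunValue P γ S N₀ N = ((lam / γ : ℝ) : EReal))) := by
  have hwm : Measurable (Portfolio.priceRatio S 0) := by
    have h0 := (hSmeas 0).mono (ℱ.le 0) le_rfl
    have h1 := (hSmeas 1).mono (ℱ.le 1) le_rfl
    exact measurable_pi_lambda _ fun i =>
      ((measurable_pi_apply i).comp h1).div ((measurable_pi_apply i).comp h0)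
  obtain ⟨v, g, lam, hg, hv, u₀, hu₀m, hu₀⟩ := Portfolio.exists_bellman_solution hd hc hh hγ hwm
    (Portfolio.priceRatio_pos hSpos 0) (P := P) fun i => (hA1 i).1
  have hobj := Portfolio.bellmanObjective_eq (P := P) (c := c) (h := h) hγ hg
  have hγi : γ⁻¹ < 0 := inv_lt_zero.2 hγ
  have hbest : ∀ p q : stdSimplex ℝ (Fin d),
      Portfolio.bellmanObjective P γ (Portfolio.priceRatio S 0) c h (Portfolio.extendByZero v)
        p.1 q.1 ≤ ((γ⁻¹ * (v p + lam) : ℝ) : EReal) := fun p q => by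
    rw [hobj p q, EReal.coe_le_coe_iff]
    exact mul_le_mul_of_nonpos_left (hv p q) hγi.le
  have hattain : ∀ p : stdSimplex ℝ (Fin d),
      Portfolio.bellmanObjective P γ (Portfolio.priceRatio S 0) c h (Portfolio.extendByZero v)
        p.1 (u₀ p).1 = ((γ⁻¹ * (v p + lam) : ℝ) : EReal) := fun p => by
    rw [hobj p (u₀ p), hu₀ p]
  have hselector : ∃ u, Portfolio.IsBellmanSelector P γ (Portfolio.priceRatio S 0) c h
      (Portfolio.extendByZero v) u := by
    have hext : ∀ p (hp : p ∈ stdSimplex ℝ (Fin d)), Function.extend Subtype.val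
        (fun p : stdSimplex ℝ (Fin d) => (u₀ p).1) 0 p = (u₀ ⟨p, hp⟩).1 := fun p hp =>
      Subtype.val_injective.extend_apply _ _ ⟨p, hp⟩
    refine ⟨Function.extend Subtype.val (fun p : stdSimplex ℝ (Fin d) => (u₀ p).1) 0,
      ⟨?_, fun p hp => ?_, fun p hp q hq => ?_⟩⟩
    · exact (MeasurableEmbedding.subtype_coe
        (isClosed_stdSimplex ℝ (Fin d)).measurableSet).measurable_extend
          (measurable_subtype_coe.comp hu₀m) measurable_zero
    · rw [hext p hp]
      exact (u₀ ⟨p, hp⟩).2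
    · rw [hext p hp, hattain ⟨p, hp⟩]
      exact hbest ⟨p, hp⟩ ⟨q, hq⟩
  have hselector_eq : ∀ u, Portfolio.IsBellmanSelector P γ (Portfolio.priceRatio S 0) c h
      (Portfolio.extendByZero v) u → ∀ p q : stdSimplex ℝ (Fin d), q.1 = u p.1 →
        v p + lam = γ * Real.log (Portfolio.decay c h p.1 q.1) + g q := by
    intro u hu p q hq
    refine le_antisymm (hv p q) ?_
    -- The selector does at least as well as the known maximiser, and the factor `γ⁻¹` reverses the
    -- comparison.
    have h1 := hu.isMax p.1 p.2 (u₀ p).1 (u₀ p).2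
    rw [hattain, ← hq, hobj p q, EReal.coe_le_coe_iff] at h1
    exact (mul_le_mul_left_of_neg hγi).1 h1
  have hupper : ∀ N₀, Portfolio.IsEndowment ℱ S N₀ →
      ∀ N, Portfolio.IsTradingStrategy ℱ S c h N₀ N →
        Portfolio.longRunValue P γ S N₀ N ≤ ((lam / γ : ℝ) : EReal) := fun N₀ hN₀ N hN =>
    Portfolio.longRunValue_le_of_bellman hγ hc hh hSpos hSmeas hident hindep hg hv hN₀ hN
  have hlower : ∀ u, Portfolio.IsBellmanSelector P γ (Portfolio.priceRatio S 0) c h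
      (Portfolio.extendByZero v) u → ∀ N₀, Portfolio.IsEndowment ℱ S N₀ →
      ∀ N, Portfolio.IsTradingStrategy ℱ S c h N₀ N →
      (∀ t ω, Portfolio.postWeights S N t ω = u (Portfolio.preWeights S N₀ N t ω)) →
        ((lam / γ : ℝ) : EReal) ≤ Portfolio.longRunValue P γ S N₀ N :=
    fun u hu N₀ hN₀ N hN hNu => Portfolio.le_longRunValue_of_selector hγ hc hh hSpos hSmeas hident
      hindep hg (hselector_eq u hu) hN₀ hN hNu
  refine ⟨lam, Portfolio.extendByZero v, ?_, ⟨‖v‖, fun p hp => Portfolio.abs_extendByZero_le v hp⟩,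
    fun p hp => ?_, fun N₀ hN₀ => ?_, hselector, fun u hu N₀ hN₀ => ⟨?_, fun N hN hNu => ?_⟩⟩
  · rw [continuousOn_iff_continuous_domRestrict]
    convert! v.continuous using 1
    funext p
    exact Portfolio.extendByZero_apply v p.2
  · have hsup : (⨆ q ∈ stdSimplex ℝ (Fin d), Portfolio.bellmanObjective P γ
        (Portfolio.priceRatio S 0) c h (Portfolio.extendByZero v) p q) =
          ((γ⁻¹ * (v ⟨p, hp⟩ + lam) : ℝ) : EReal) := by
      refine le_antisymm (iSup₂_le fun q hq => hbest ⟨p, hp⟩ ⟨q, hq⟩) ?_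
      rw [← hattain ⟨p, hp⟩]
      exact le_iSup₂_of_le (u₀ ⟨p, hp⟩).1 (u₀ ⟨p, hp⟩).2 le_rfl
    rw [hsup, ← EReal.coe_mul, mul_inv_cancel_left₀ hγ.ne, Portfolio.extendByZero_apply v hp]
  · refine le_antisymm (iSup₂_le fun N hN => hupper N₀ hN₀ N hN) ?_
    obtain ⟨u, hu⟩ := hselector
    obtain ⟨N, hN, hNu⟩ := Portfolio.exists_tradingStrategy_of_selector hc hh hSpos hSmeas hN₀
      hu.measurable hu.mem
    exact le_iSup₂_of_le N hN (hlower u hu N₀ hN₀ N hN hNu)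
  · exact Portfolio.exists_tradingStrategy_of_selector hc hh hSpos hSmeas hN₀ hu.measurable hu.mem
  · exact le_antisymm (hupper N₀ hN₀ N hN) (hlower u hu N₀ hN₀ N hN hNu)
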